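/- **Setting.** Let $G$ be a (Hausdorff) locally compact group and let $\mathbb K$ be $\mathbb R$ or $\mathbb C$. $M(G)$ denotes the space of bounded $\mathbb K$-valued Radon measures on $G$ with the total variation norm $\|\mu\|=|\mu|(G)$ and with convolution $(\mu\star\nu)(E)=\int \nu(x^{-1}E)\,d\mu(x)$ ($E$ Borel). Write $\nu\ll\mu$ for $|\nu|\ll|\mu|$ and $\mu\perp\nu$ for $|\mu|\perp|\nu|$; for sets of measures, $D\perp D'$ means $\mu\perp\nu$ for all $\mu\in D,\ \nu\in D'$. $M_a(G)$ and $M_s(G)$ are the sets of $\mu\in M(G)$ that are absolutely continuous, respectively singular, with respect to Haar measure. For a compact subgroup $K$, $\lambda_K$ is its normalized Haar measure, considered as a measure on $G$, and $M(G/K)$ is identified with $\{\mu\in M(G):\mu\star\lambda_K=\mu\}$. The character $\chi(\Omega)$ of a homogeneous space $\Omega$ ($\Omega=G$ or $\Omega=G/K$, the space of left cosets) is the least cardinality of a base of neighbourhoods of a point. For a cardinal $\tau$ with $\aleph_0\le\tau\le\chi(G)$ let $$M_\tau(G)=\bigcup\{M(G/K): K \text{ a compact subgroup of } G,\ \chi(G/K)\le\tau\}$$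 (the measures of character $\tau$). Put $M_{ss,\aleph_0}(G)=M_s(G)\cap M_{\aleph_0}(G)$ and $M_{ai,\aleph_0}(G)=M_a(G)$, and for $\tau>\aleph_0$ $$M_{ss,\tau}(G)=\{\mu\in M_s(G)\cap M_\tau(G): \mu\perp M_{\tau_1}(G)\text{ for all cardinals } \aleph_0\le\tau_1<\tau\},$$ $$M_{ai,\tau}(G)=\{\mu\in M_\tau(G): \mu=\lim_K \mu\star\lambda_K\},$$ where the limit is the norm limit of the net indexed by the compact subgroups $K$ with $\chi(G/K)<\tau$, directed downwards by inclusion (the strongly singular, respectively approximately invariant, measures of character $\tau$). For a compact subgroup $K$ that is not open (so that $\chi(G/K)\ge\aleph_0$) put $M_{ss}(G,K)=M(G/K)\cap M_{ss,\chi(G/K)}(G)$ and $M_{ai}(G,K)=M(G/K)\cap M_{ai,\chi(G/K)}(G)$. **Theorem.** Let $G$ be a non-discrete locally compact group, $\tau$ a cardinal with $\aleph_0\le\tau\le\chi(G)$, and $K$ a non-open compact subgroup of $G$. (i) $M_\tau(G)$ and $M_{ai,\tau}(G)$ are norm closed (two-sided) ideals of $M(G)$, and $M_{ss,\tau}(G)$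 is a norm closed subspace. (ii) $M_\tau(G)$, $M_{ai,\tau}(G)$ and $M_{ss,\tau}(G)$ are L-subspaces (i.e. linear subspaces $M$ such that $\mu\in M$ and $|\nu|\ll|\mu|$ imply $\nu\in M$). Moreover $M_\tau(G)=M_{ss,\tau}(G)\oplus M_{ai,\tau}(G)$ and $M_{ss,\tau}(G)\perp M_{ai,\tau}(G)$. (iii) $M(G/K)$, $M_{ai}(G,K)$ and $M_{ss}(G,K)$ are norm closed subspaces and vector sublattices of $M(G)$ (i.e. $\mu\in M$ implies $|\mu|\in M$). Moreover $M(G/K)=M_{ss}(G,K)\oplus M_{ai}(G,K)$ and $M_{ss}(G,K)\perp M_{ai}(G,K)$. -/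

import Mathlib

open MeasureTheory Topology Filter Set
open scoped ENNReal NNReal Cardinal

namespace RadonConv

section Positive

variable {G : Type*} [TopologicalSpace G] [MeasurableSpace G] [BorelSpace G]

theorem regular_of_open_approx [T2Space G] (m : Measure G) [IsFiniteMeasure m]
    (h : ∀ U : Set G, IsOpen U → ∀ ε : ℝ≥0∞, ε ≠ 0 →
      ∃ K, K ⊆ U ∧ IsCompact K ∧ m U ≤ m K + ε) : m.Regular := by
  have H : m.InnerRegularWRT IsCompact IsOpen := by
    intro U hU r hr
    obtain ⟨s, hrs, hs⟩ := exists_between hr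
    obtain ⟨K, hKU, hK, hle⟩ := h U hU (s - r) (tsub_pos_of_lt hrs).ne'
    refine ⟨K, hKU, hK, ?_⟩
    by_contra hcon
    push Not at hcon
    have : m U ≤ s := hle.trans (by
      calc m K + (s - r) ≤ r + (s - r) := by gcongr
        _ = s := add_tsub_cancel_of_le hrs.le)
    exact absurd hs (not_lt.mpr this)
  have H' : m.InnerRegularWRT IsClosed IsOpen := by
    intro U hU r hr
    obtain ⟨K, hKU, hK, h'⟩ := H hU r hr
    exact ⟨K, hKU, hK.isClosed, h'⟩
  have := H'.weaklyRegular_of_finite m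
  exact { innerRegular := H }

theorem regular_of_le [T2Space G] {m n : Measure G} [IsFiniteMeasure n] [n.Regular] (h : m ≤ n) :
    m.Regular := by
  have : IsFiniteMeasure m := isFiniteMeasure_of_le n h
  refine regular_of_open_approx m fun U hU ε hε => ?_
  obtain ⟨K, hKU, hK, hlt⟩ := hU.measurableSet.exists_isCompact_sdiff_lt (measure_ne_top n U) hε
  refine ⟨K, hKU, hK, ?_⟩
  calc m U = m (K ∪ U \ K) := by rw [union_sdiff_cancel hKU]
    _ ≤ m K + m (U \ K) := measure_union_le _ _
    _ ≤ m K + ε := by gcongr; exact (h _).trans hlt.le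

variable [Group G] [IsTopologicalGroup G]

theorem measurable_preimage_mul (n : Measure G) [IsFiniteMeasure n] [n.Regular]
    {E : Set G} (hE : MeasurableSet E) : Measurable fun x : G => n ((x * ·) ⁻¹' E) := by
  have hm : ∀ x : G, Measurable (x * · : G → G) := fun x => (continuous_const_mul x).measurable
  induction E, hE using MeasurableSpace.induction_on_inter
    (BorelSpace.measurable_eq (α := G)) isPiSystem_isOpen with
  | empty => simp
  | basic U hU =>
    have hU : IsOpen U := hU
    refine LowerSemicontinuous.measurable fun x c hc => ?_
    obtain ⟨K, hKU, hK, hcK⟩ :=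
      (hU.preimage (continuous_const_mul x)).exists_lt_isCompact hc
    have : ∀ᶠ y in 𝓝 x, ∀ k ∈ K, y * k ∈ U := by
      refine hK.eventually_forall_of_forall_eventually fun k hk => ?_
      exact (continuous_mul.tendsto (x, k)) (hU.mem_nhds (hKU hk))
    filter_upwards [this] with y hy
    exact hcK.trans_le (measure_mono hy)
  | compl t ht ih =>
    have : (fun x : G => n ((x * ·) ⁻¹' tᶜ)) = fun x => n univ - n ((x * ·) ⁻¹' t) := by
      funext x
      rw [preimage_compl, measure_compl (hm x ht) (measure_ne_top _ _)]
    rw [this]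
    exact measurable_const.sub ih
  | iUnion f hd hf ih =>
    have : (fun x : G => n ((x * ·) ⁻¹' ⋃ i, f i)) = fun x => ∑' i, n ((x * ·) ⁻¹' f i) := by
      funext x
      rw [preimage_iUnion, measure_iUnion (fun i j hij => (hd hij).preimage _)
        (fun i => hm x (hf i))]
    rw [this]
    exact Measurable.tsum ih

/-- Convolution of positive measures: `E ↦ ∫⁻ n (x⁻¹ E) dm(x)`. -/
noncomputable def posConv (m n : Measure G) : Measure G :=
  m.bind fun x => n.map (x * ·)

theorem posConv_apply (m n : Measure G) [IsFiniteMeasure n] [n.Regular]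
    {E : Set G} (hE : MeasurableSet E) :
    posConv m n E = ∫⁻ x, n ((x * ·) ⁻¹' E) ∂m := by
  have hm : ∀ x : G, Measurable (x * · : G → G) := fun x => (continuous_const_mul x).measurable
  have h : Measurable fun x : G => n.map (x * ·) := by
    refine Measure.measurable_of_measurable_coe _ fun s hs => ?_
    simp_rw [Measure.map_apply (hm _) hs]
    exact measurable_preimage_mul n hs
  rw [posConv, Measure.bind_apply hE h.aemeasurable]
  simp_rw [Measure.map_apply (hm _) hE]

theorem isFiniteMeasure_posConv (m n : Measure G) [IsFiniteMeasure m] [IsFiniteMeasure n]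
    [n.Regular] : IsFiniteMeasure (posConv m n) := by
  constructor
  rw [posConv_apply m n MeasurableSet.univ]
  simp only [preimage_univ, lintegral_const]
  exact ENNReal.mul_lt_top (measure_lt_top _ _) (measure_lt_top _ _)

theorem regular_posConv [T2Space G] [LocallyCompactSpace G] (m n : Measure G) [IsFiniteMeasure m]
    [IsFiniteMeasure n] [m.Regular] [n.Regular] : (posConv m n).Regular := by
  have := isFiniteMeasure_posConv m n
  refine regular_of_open_approx _ fun U hU ε hε => ?_
  wlog hεt : ε ≠ ∞ generalizing ε
  · push Not at hεt
    exact ⟨∅, empty_subset _, isCompact_empty, by simp [hεt]⟩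
  set f : G → ℝ≥0 := fun x => (n ((x * ·) ⁻¹' U)).toNNReal with hf
  have hfc : ∀ x, (f x : ℝ≥0∞) = n ((x * ·) ⁻¹' U) := fun x =>
    ENNReal.coe_toNNReal (measure_ne_top _ _)
  have hint : ∫⁻ x, f x ∂m = posConv m n U := by
    simp_rw [hfc, posConv_apply m n hU.measurableSet]
  obtain ⟨δ, hδ0, hδ⟩ : ∃ δ : ℝ≥0, 0 < δ ∧
      (δ : ℝ≥0∞) + 2 * δ * m univ + δ * n univ ≤ ε := by
    obtain ⟨δ, h0, hlt⟩ := ENNReal.exists_nnreal_pos_mul_lt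
      (a := 1 + 2 * m univ + n univ) (b := ε) (by finiteness) hε
    exact ⟨δ, h0, le_trans (le_of_eq (by ring)) hlt.le⟩
  have hδe : (δ : ℝ≥0∞) ≠ 0 := by exact_mod_cast hδ0.ne'
  obtain ⟨g, hgf, hgu, hg⟩ := exists_upperSemicontinuous_le_lintegral_le (μ := m) f
    (by rw [hint]; exact measure_ne_top _ _) hδe
  obtain ⟨A, -, hA, hAlt⟩ := MeasurableSet.univ.exists_isCompact_sdiff_lt
    (measure_ne_top m univ) hδe
  obtain ⟨K, hKU, hK, hKA⟩ : ∃ K, K ⊆ U ∧ IsCompact K ∧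
      ∀ y ∈ A, (g y : ℝ≥0∞) ≤ n ((y * ·) ⁻¹' K) + 2 * δ := by
    refine hA.induction_on (p := fun S => ∃ K, K ⊆ U ∧ IsCompact K ∧
      ∀ y ∈ S, (g y : ℝ≥0∞) ≤ n ((y * ·) ⁻¹' K) + 2 * δ) ?_ ?_ ?_ ?_
    · exact ⟨∅, empty_subset _, isCompact_empty, by simp⟩
    · rintro s t hst ⟨K, h1, h2, h3⟩
      exact ⟨K, h1, h2, fun y hy => h3 y (hst hy)⟩
    · rintro s t ⟨K, h1, h2, h3⟩ ⟨L, h4, h5, h6⟩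
      refine ⟨K ∪ L, union_subset h1 h4, h2.union h5, ?_⟩
      rintro y (hy | hy)
      · refine (h3 y hy).trans ?_
        gcongr
        exact subset_union_left
      · refine (h6 y hy).trans ?_
        gcongr
        exact subset_union_right
    · intro x _
      have hxU : IsOpen ((x * ·) ⁻¹' U) := hU.preimage (continuous_const_mul x)
      obtain ⟨C, hCU, hC, hClt⟩ := hxU.measurableSet.exists_isCompact_lt_add
        (measure_ne_top n _) hδe
      obtain ⟨N, hN, hCN, hNU⟩ := exists_compact_between (hC.image (continuous_const_mul x)) hU
        (by rintro _ ⟨c, hc, rfl⟩; exact hCU hc)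
      have h1 : ∀ᶠ y in 𝓝 x, ∀ c ∈ C, y * c ∈ interior N := by
        refine hC.eventually_forall_of_forall_eventually fun c hc => ?_
        exact (continuous_mul.tendsto (x, c))
          (isOpen_interior.mem_nhds (hCN (mem_image_of_mem _ hc)))
      have h2 : ∀ᶠ y in 𝓝 x, g y < g x + δ := hgu x _ (lt_add_of_pos_right _ hδ0)
      refine ⟨_, mem_nhdsWithin_of_mem_nhds (h1.and h2), N, hNU, hN, ?_⟩
      rintro y ⟨hy1, hy2⟩
      calc (g y : ℝ≥0∞) ≤ g x + δ := by exact_mod_cast hy2.le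
        _ ≤ f x + δ := by gcongr; exact_mod_cast hgf x
        _ ≤ (n C + δ) + δ := by rw [hfc]; gcongr
        _ = n C + 2 * δ := by ring
        _ ≤ n ((y * ·) ⁻¹' N) + 2 * δ := by
          gcongr
          exact fun c hc => interior_subset (s := N) (hy1 c hc)
  refine ⟨K, hKU, hK, ?_⟩
  have hAm : MeasurableSet A := hA.measurableSet
  have hmeas := measurable_preimage_mul n hK.measurableSet
  calc posConv m n U ≤ ∫⁻ x, g x ∂m + δ := by rw [← hint]; exact hg
    _ = (∫⁻ x in A, g x ∂m + ∫⁻ x in Aᶜ, g x ∂m) + δ := by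
      rw [lintegral_add_compl _ hAm]
    _ ≤ (∫⁻ x in A, (n ((x * ·) ⁻¹' K) + 2 * δ) ∂m + ∫⁻ x in Aᶜ, n univ ∂m) + δ := by
      gcongr ?_ + ?_ + _
      · exact setLIntegral_mono' hAm hKA
      · refine lintegral_mono fun x => ?_
        calc (g x : ℝ≥0∞) ≤ f x := by exact_mod_cast hgf x
          _ ≤ n univ := by rw [hfc]; exact measure_mono (subset_univ _)
    _ ≤ ((∫⁻ x, n ((x * ·) ⁻¹' K) ∂m + 2 * δ * m univ) + n univ * δ) + δ := by
      gcongr ?_ + ?_ + _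
      · refine (setLIntegral_le_lintegral _ _).trans ?_
        rw [lintegral_add_left hmeas, lintegral_const]
      · rw [setLIntegral_const]
        gcongr
        rw [compl_eq_univ_sdiff]; exact hAlt.le
    _ = posConv m n K + (δ + 2 * δ * m univ + δ * n univ) := by
      rw [posConv_apply m n hK.measurableSet]; ring
    _ ≤ posConv m n K + ε := by gcongr

end Positive

section Vector

theorem variation_mapRange_le {𝕜 : Type*} [RCLike 𝕜] {G : Type*} [MeasurableSpace G] {F : Type*} [NormedAddCommGroup F] (ν : VectorMeasure G 𝕜)
    (L : 𝕜 →+ F) (hL : Continuous L) (h : ∀ z, ‖L z‖ ≤ ‖z‖) :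
    (ν.mapRange L hL).variation ≤ ν.variation := by
  refine VectorMeasure.variation_le_of_forall_enorm_le fun E _ => ?_
  refine le_trans ?_ (VectorMeasure.enorm_measure_le_variation ν E)
  rw [VectorMeasure.mapRange_apply]
  exact enorm_le_iff_norm_le.mpr (h _)

variable {𝕜 : Type*} [RCLike 𝕜] {G : Type*} [TopologicalSpace G] [MeasurableSpace G]
  [BorelSpace G]

variable (𝕜 G) in
/-- The bounded Radon measures on `G` with values in `𝕜`: the countably additive Borel set
functions whose total variation is finite and regular. -/
def radonSubmodule [T2Space G] : Submodule 𝕜 (VectorMeasure G 𝕜) where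
  carrier := {μ | IsFiniteMeasure μ.variation ∧ μ.variation.Regular}
  zero_mem' := by
    simp only [mem_ofPred_eq, VectorMeasure.variation_zero]
    exact ⟨inferInstance, inferInstance⟩
  add_mem' := by
    rintro μ ν ⟨h1, h2⟩ ⟨h3, h4⟩
    have h : (μ.variation + ν.variation).Regular := by
      refine regular_of_open_approx _ fun U hU ε hε => ?_
      have hε2 : ε / 2 ≠ 0 := (ENNReal.half_pos hε).ne'
      obtain ⟨K, hKU, hK, hlt⟩ :=
        hU.measurableSet.exists_isCompact_lt_add (measure_ne_top μ.variation U) hε2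
      obtain ⟨L, hLU, hL, hlt'⟩ :=
        hU.measurableSet.exists_isCompact_lt_add (measure_ne_top ν.variation U) hε2
      refine ⟨K ∪ L, union_subset hKU hLU, hK.union hL, ?_⟩
      calc μ.variation U + ν.variation U
          ≤ (μ.variation (K ∪ L) + ε / 2) + (ν.variation (K ∪ L) + ε / 2) := by
            gcongr
            · exact hlt.le.trans (by gcongr; exact subset_union_left)
            · exact hlt'.le.trans (by gcongr; exact subset_union_right)
        _ = (μ.variation + ν.variation) (K ∪ L) + (ε / 2 + ε / 2) := by
            rw [Measure.add_apply]; ring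
        _ = (μ.variation + ν.variation) (K ∪ L) + ε := by rw [ENNReal.add_halves]
    exact ⟨isFiniteMeasure_of_le _ VectorMeasure.variation_add_le,
      regular_of_le VectorMeasure.variation_add_le⟩
  smul_mem' := by
    rintro c μ ⟨h1, h2⟩
    simp only [mem_ofPred_eq, VectorMeasure.variation_smul]
    exact ⟨inferInstance, inferInstance⟩

variable (𝕜 G) in
/-- The space `M(G)` of bounded `𝕜`-valued Radon measures. -/
abbrev RadonMeasure [T2Space G] : Type _ := radonSubmodule 𝕜 G

namespace RadonMeasure

variable [T2Space G]

/-- The total variation measure `|μ|`. -/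
noncomputable def tv (μ : RadonMeasure 𝕜 G) : Measure G := μ.1.variation

instance (μ : RadonMeasure 𝕜 G) : IsFiniteMeasure μ.tv := μ.2.1
instance (μ : RadonMeasure 𝕜 G) : μ.tv.Regular := μ.2.2

/-- The total variation norm `‖μ‖ = |μ|(G)`. -/
noncomputable instance : NormedAddCommGroup (RadonMeasure 𝕜 G) :=
  AddGroupNorm.toNormedAddCommGroup
    { toFun := fun μ => μ.tv.real univ
      map_zero' := by simp [tv]
      add_le' := fun μ ν => by
        have h : (μ + ν).tv ≤ μ.tv + ν.tv := VectorMeasure.variation_add_le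
        calc (μ + ν).tv.real univ ≤ (μ.tv + ν.tv).real univ :=
              ENNReal.toReal_mono (measure_ne_top _ _) (h univ)
          _ = _ := measureReal_add_apply
      neg' := fun μ => by simp [tv]
      eq_zero_of_map_eq_zero' := fun μ h => by
        have h0 : μ.tv univ = 0 := by
          simpa [Measure.real, ENNReal.toReal_eq_zero_iff] using h
        have : μ.1.variation = 0 := Measure.measure_univ_eq_zero.mp h0
        exact Subtype.ext (VectorMeasure.variation_eq_zero.mp this) }

theorem norm_def (μ : RadonMeasure 𝕜 G) : ‖μ‖ = μ.tv.real univ := rfl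

noncomputable instance : NormedSpace 𝕜 (RadonMeasure 𝕜 G) where
  norm_smul_le c μ := by
    simp [norm_def, tv, VectorMeasure.variation_smul]

/-- A finite positive regular measure, as an element of `M(G)`. -/
noncomputable def ofMeasure (m : Measure G) [IsFiniteMeasure m] [m.Regular] :
    RadonMeasure 𝕜 G :=
  ⟨m.toSignedMeasure.mapRange (algebraMap ℝ 𝕜).toAddMonoidHom
      (by exact RCLike.continuous_ofReal), by
    have h := variation_mapRange_le (𝕜 := ℝ) m.toSignedMeasure (algebraMap ℝ 𝕜).toAddMonoidHom
      (by exact RCLike.continuous_ofReal) (fun z => by simp)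
    rw [Measure.variation_toSignedMeasure] at h
    exact ⟨isFiniteMeasure_of_le _ h, regular_of_le h⟩⟩

theorem ofMeasure_apply (m : Measure G) [IsFiniteMeasure m] [m.Regular] {E : Set G}
    (hE : MeasurableSet E) : (ofMeasure m : RadonMeasure 𝕜 G).1 E = ((m.real E : ℝ) : 𝕜) := by
  simp [ofMeasure, hE]

/-- The absolute value `|μ|` as an element of `M(G)`. -/
noncomputable def absVal (μ : RadonMeasure 𝕜 G) : RadonMeasure 𝕜 G := ofMeasure μ.tv

variable [Group G] [IsTopologicalGroup G]

theorem measurable_signed_preimage_mul (ν : SignedMeasure G) [IsFiniteMeasure ν.variation]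
    [ν.variation.Regular] {E : Set G} (hE : MeasurableSet E) :
    Measurable fun x : G => ν ((x * ·) ⁻¹' E) := by
  have hm : ∀ x : G, Measurable (x * · : G → G) := fun x => (continuous_const_mul x).measurable
  have hle := ν.totalVariation_eq_variation
  rw [SignedMeasure.totalVariation] at hle
  have hp : ν.toJordanDecomposition.posPart ≤ ν.variation := by
    rw [← hle]; exact Measure.le_add_right le_rfl
  have hn : ν.toJordanDecomposition.negPart ≤ ν.variation := by
    rw [← hle]; exact Measure.le_add_left le_rfl
  have := regular_of_le hp
  have := regular_of_le hn
  have heq : (fun x : G => ν ((x * ·) ⁻¹' E)) = fun x =>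
      (ν.toJordanDecomposition.posPart ((x * ·) ⁻¹' E)).toReal -
        (ν.toJordanDecomposition.negPart ((x * ·) ⁻¹' E)).toReal := by
    funext x
    exact ν.apply_eq_posPart_real_sub_negPart_real (hm x hE)
  rw [heq]
  exact (measurable_preimage_mul _ hE).ennreal_toReal.sub
    (measurable_preimage_mul _ hE).ennreal_toReal

theorem measurable_vector_preimage_mul (ν : RadonMeasure 𝕜 G) {E : Set G}
    (hE : MeasurableSet E) : Measurable fun x : G => ν.1 ((x * ·) ⁻¹' E) := by
  have hr := variation_mapRange_le ν.1 (RCLike.re (K := 𝕜)) RCLike.continuous_re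
    (fun z => by simpa using RCLike.abs_re_le_norm z)
  have hi := variation_mapRange_le ν.1 (RCLike.im (K := 𝕜)) RCLike.continuous_im
    (fun z => by simpa using RCLike.abs_im_le_norm z)
  have : IsFiniteMeasure ν.1.variation := ν.2.1
  have : ν.1.variation.Regular := ν.2.2
  have := isFiniteMeasure_of_le _ hr
  have := isFiniteMeasure_of_le _ hi
  have := regular_of_le hr
  have := regular_of_le hi
  have h1 := measurable_signed_preimage_mul (ν.1.mapRange _ RCLike.continuous_re) hE
  have h2 := measurable_signed_preimage_mul (ν.1.mapRange _ RCLike.continuous_im) hE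
  simp only [VectorMeasure.mapRange_apply] at h1 h2
  exact measurable_of_re_im h1 h2

/-- The value of the convolution on a Borel set: `(μ ⋆ ν)(E) = ∫ ν(x⁻¹ E) dμ(x)`. -/
noncomputable def convFun (μ ν : RadonMeasure 𝕜 G) (E : Set G) : 𝕜 :=
  ∫ᵛ x, ν.1 ((x * ·) ⁻¹' E) ∂[ContinuousLinearMap.mul ℝ 𝕜; μ.1]

theorem integrable_preimage_mul (μ ν : RadonMeasure 𝕜 G) {E : Set G} (hE : MeasurableSet E) :
    μ.1.Integrable fun x : G => ν.1 ((x * ·) ⁻¹' E) := by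
  refine Integrable.of_bound (C := ν.tv.real univ) (μ := μ.tv)
    (measurable_vector_preimage_mul ν hE).aestronglyMeasurable (ae_of_all _ fun x => ?_)
  have : IsFiniteMeasure ν.1.variation := ν.2.1
  exact (VectorMeasure.norm_measure_le_variation).trans
    (measureReal_mono (μ := ν.tv) (subset_univ _))

theorem enorm_convFun_le (μ ν : RadonMeasure 𝕜 G) {E : Set G} (hE : MeasurableSet E) :
    ‖convFun μ ν E‖ₑ ≤ posConv μ.tv ν.tv E := by
  rw [posConv_apply _ _ hE]
  have h1 : ‖ContinuousLinearMap.mul ℝ 𝕜‖ₑ ≤ 1 := by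
    rw [← enorm_one (G := ℝ)]
    exact enorm_le_iff_norm_le.mpr (by simp)
  refine (VectorMeasure.enorm_integral_le_lintegral_enorm).trans ?_
  refine (mul_le_mul_left h1 _).trans ?_
  rw [one_mul]
  exact lintegral_mono fun x => VectorMeasure.enorm_measure_le_variation _ _

theorem convFun_iUnion (μ ν : RadonMeasure 𝕜 G) {f : ℕ → Set G}
    (hf : ∀ i, MeasurableSet (f i)) (hd : Pairwise (Function.onFun Disjoint f)) :
    HasSum (fun i => convFun μ ν (f i)) (convFun μ ν (⋃ i, f i)) := by
  have hm : ∀ x : G, Measurable (x * · : G → G) := fun x => (continuous_const_mul x).measurable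
  have := isFiniteMeasure_posConv μ.tv ν.tv
  set P := posConv μ.tv ν.tv with hP
  have hU : MeasurableSet (⋃ i, f i) := MeasurableSet.iUnion hf
  have key : ∀ s : Finset ℕ, ‖(∑ i ∈ s, convFun μ ν (f i)) - convFun μ ν (⋃ i, f i)‖ₑ ≤
      P (⋃ i, f i) - ∑ i ∈ s, P (f i) := by
    intro s
    have hA : MeasurableSet (⋃ i ∈ s, f i) := s.measurableSet_biUnion fun i _ => hf i
    have hAU : (⋃ i ∈ s, f i) ⊆ ⋃ i, f i := iUnion₂_subset_iUnion _ _
    have hPs : P (⋃ i ∈ s, f i) = ∑ i ∈ s, P (f i) :=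
      measure_biUnion_finset (fun i _ j _ hij => hd hij) fun i _ => hf i
    rw [← hPs, ← measure_sdiff hAU hA.nullMeasurableSet (measure_ne_top _ _), ← enorm_neg, neg_sub]
    refine le_trans (le_of_eq ?_) (enorm_convFun_le μ ν (hU.diff hA))
    congr 1
    have hpt : ∀ x : G, ν.1 ((x * ·) ⁻¹' ((⋃ i, f i) \ ⋃ i ∈ s, f i)) =
        ν.1 ((x * ·) ⁻¹' ⋃ i, f i) - ∑ i ∈ s, ν.1 ((x * ·) ⁻¹' f i) := by
      intro x
      have h1 : ν.1 ((x * ·) ⁻¹' ⋃ i ∈ s, f i) = ∑ i ∈ s, ν.1 ((x * ·) ⁻¹' f i) := by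
        rw [preimage_iUnion₂]
        exact VectorMeasure.of_biUnion_finset (v := ν.1) (fun i _ j _ hij => (hd hij).preimage _)
          fun i _ => hm x (hf i)
      rw [← h1, preimage_sdiff]
      exact VectorMeasure.of_sdiff (hm x hA) (hm x hU) (preimage_mono hAU)
    have hI : ∀ i ∈ s, μ.1.Integrable fun x : G => ν.1 ((x * ·) ⁻¹' f i) := fun i _ =>
      integrable_preimage_mul μ ν (hf i)
    simp only [convFun]
    rw [← VectorMeasure.integral_finsetSum s hI, ← VectorMeasure.integral_fun_sub
      (integrable_preimage_mul μ ν hU) (VectorMeasure.Integrable.fun_finsetSum s hI)]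
    simp_rw [hpt]
  have hlim : Tendsto (fun s : Finset ℕ => P (⋃ i, f i) - ∑ i ∈ s, P (f i)) atTop (𝓝 0) := by
    have h1 : Tendsto (fun s : Finset ℕ => ∑ i ∈ s, P (f i)) atTop (𝓝 (P (⋃ i, f i))) := by
      rw [measure_iUnion hd hf]
      exact ENNReal.summable.hasSum
    simpa using ENNReal.Tendsto.sub (tendsto_const_nhds (x := P (⋃ i, f i))) h1
      (Or.inl (measure_ne_top _ _))
  rw [HasSum, SummationFilter.unconditional_filter, tendsto_iff_edist_tendsto_0]
  refine tendsto_of_tendsto_of_tendsto_of_le_of_le tendsto_const_nhds hlim (fun _ => zero_le) ?_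
  intro s
  simp only [edist_eq_enorm_sub]
  exact key s

open Classical in
/-- The convolution of two bounded Radon measures, `(μ ⋆ ν)(E) = ∫ ν(x⁻¹ E) dμ(x)` for all Borel
sets `E`. (The integrand is Borel measurable since `ν` is Radon; the product σ-algebra on `G × G`
is not used, because multiplication need not be measurable for it.) -/
noncomputable def conv [LocallyCompactSpace G] (μ ν : RadonMeasure 𝕜 G) : RadonMeasure 𝕜 G :=
  ⟨{ measureOf' := fun E => if MeasurableSet E then convFun μ ν E else 0
     empty' := by simp [convFun]
     not_measurable' := fun E hE => if_neg hE
     m_iUnion' := fun f hf hd => by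
       simp only [hf, MeasurableSet.iUnion hf, if_true]
       exact convFun_iUnion μ ν hf hd }, by
    have := isFiniteMeasure_posConv μ.tv ν.tv
    have := regular_posConv μ.tv ν.tv
    refine (fun h => ⟨isFiniteMeasure_of_le _ h, regular_of_le h⟩ :
      VectorMeasure.variation _ ≤ posConv μ.tv ν.tv → _) ?_
    refine VectorMeasure.variation_le_of_forall_enorm_le fun E hE => ?_
    exact le_trans (le_of_eq (congrArg _ (if_pos hE))) (enorm_convFun_le μ ν hE)⟩

theorem conv_apply [LocallyCompactSpace G] (μ ν : RadonMeasure 𝕜 G) {E : Set G}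
    (hE : MeasurableSet E) :
    (conv μ ν).1 E = ∫ᵛ x, ν.1 ((x * ·) ⁻¹' E) ∂[ContinuousLinearMap.mul ℝ 𝕜; μ.1] :=
  if_pos hE

end RadonMeasure

end Vector

section Classes

open RadonMeasure

/-- The local weight (character) of a topological space at a point: the least cardinality of a
base of neighbourhoods of that point. -/
noncomputable def localWeight {X : Type*} [TopologicalSpace X] (x : X) : Cardinal :=
  sInf {c | ∃ B : Set (Set X), (𝓝 x).HasBasis (fun s => s ∈ B) id ∧ #B = c}

/-- The compact subgroups of `G`. -/
abbrev CompactSubgroup (G : Type*) [Group G] [TopologicalSpace G] : Type _ :=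
  {K : Subgroup G // IsCompact (K : Set G)}

variable (𝕜 : Type*) [RCLike 𝕜]
variable {G : Type*} [Group G] [TopologicalSpace G] [IsTopologicalGroup G] [T2Space G]
  [MeasurableSpace G] [BorelSpace G]

namespace CompactSubgroup

instance (K : CompactSubgroup G) : CompactSpace K.1 := isCompact_iff_compactSpace.mp K.2

/-- The normalized Haar measure `λ_K` of a compact subgroup, as a measure on `G`. -/
noncomputable def haarMeas (K : CompactSubgroup G) : Measure G :=
  (Measure.haarMeasure (⊤ : TopologicalSpace.PositiveCompacts K.1)).map Subtype.val

instance (K : CompactSubgroup G) : IsProbabilityMeasure K.haarMeas := by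
  have : IsProbabilityMeasure
      (Measure.haarMeasure (⊤ : TopologicalSpace.PositiveCompacts K.1)) :=
    ⟨by simpa using Measure.haarMeasure_self (K₀ := (⊤ : TopologicalSpace.PositiveCompacts K.1))⟩
  exact Measure.isProbabilityMeasure_map measurable_subtype_coe.aemeasurable

instance (K : CompactSubgroup G) : K.haarMeas.Regular := by
  refine regular_of_open_approx _ fun U hU ε hε => ?_
  have hV : IsOpen ((Subtype.val : K.1 → G) ⁻¹' U) := hU.preimage continuous_subtype_val
  obtain ⟨C, hCV, hC, hlt⟩ := hV.measurableSet.exists_isCompact_lt_add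
    (μ := Measure.haarMeasure (⊤ : TopologicalSpace.PositiveCompacts K.1))
    (measure_ne_top _ _) hε
  have hC' := hC.image continuous_subtype_val
  refine ⟨Subtype.val '' C, image_subset_iff.mpr hCV, hC', ?_⟩
  rw [haarMeas, Measure.map_apply measurable_subtype_coe hU.measurableSet,
    Measure.map_apply measurable_subtype_coe hC'.measurableSet]
  refine hlt.le.trans ?_
  gcongr
  exact subset_preimage_image _ _

/-- The character `χ(G/K)` of the space of left cosets, taken at the base point. -/
noncomputable def cosetChar (K : CompactSubgroup G) : Cardinal :=
  localWeight ((1 : G) : G ⧸ K.1)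

end CompactSubgroup

variable (G) in
/-- `M_a(G)`: the measures that are absolutely continuous with respect to Haar measure. -/
def acMeas [LocallyCompactSpace G] : Set (RadonMeasure 𝕜 G) :=
  {μ | μ.tv ≪ (Measure.haar : Measure G)}

variable (G) in
/-- `M_s(G)`: the measures that are singular to Haar measure. -/
def singMeas [LocallyCompactSpace G] : Set (RadonMeasure 𝕜 G) :=
  {μ | μ.tv ⟂ₘ (Measure.haar : Measure G)}

/-- `M(G/K)`, identified with the space `M(G,K)` of all `μ` in `M(G)` such that
`μ ⋆ λ_K = μ`. -/
def cosetMeas [LocallyCompactSpace G] (K : CompactSubgroup G) : Set (RadonMeasure 𝕜 G) :=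
  {μ | conv μ (ofMeasure K.haarMeas) = μ}

variable (G) in
/-- `M_τ(G)`: the measures of character `τ`, i.e. the union of the spaces `M(G/K)` over all
compact subgroups `K` such that `χ(G/K) ≤ τ`. -/
def charMeas [LocallyCompactSpace G] (τ : Cardinal) : Set (RadonMeasure 𝕜 G) :=
  {μ | ∃ K : CompactSubgroup G, K.cosetChar ≤ τ ∧ μ ∈ cosetMeas 𝕜 K}

open Classical in
variable (G) in
/-- The strongly singular measures of character `τ`. -/
def ssMeas [LocallyCompactSpace G] (τ : Cardinal) : Set (RadonMeasure 𝕜 G) :=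
  if τ = ℵ₀ then singMeas 𝕜 G ∩ charMeas 𝕜 G ℵ₀
  else {μ | μ ∈ singMeas 𝕜 G ∩ charMeas 𝕜 G τ ∧
    ∀ τ₁, ℵ₀ ≤ τ₁ → τ₁ < τ → ∀ ν ∈ charMeas 𝕜 G τ₁, μ.tv ⟂ₘ ν.tv}

open Classical in
variable (G) in
/-- The approximately invariant measures of character `τ`. For `τ ≠ ℵ₀` the condition is that
`μ` is the norm limit of the net `μ ⋆ λ_K`, where `K` runs through the compact subgroups with
`χ(G/K) < τ`, directed downwards by inclusion. -/
def aiMeas [LocallyCompactSpace G] (τ : Cardinal) : Set (RadonMeasure 𝕜 G) :=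
  if τ = ℵ₀ then acMeas 𝕜 G
  else {μ | μ ∈ charMeas 𝕜 G τ ∧ ∀ ε : ℝ, 0 < ε →
    ∃ K₀ : CompactSubgroup G, K₀.cosetChar < τ ∧
      ∀ K : CompactSubgroup G, K.cosetChar < τ → K ≤ K₀ →
        ‖conv μ (ofMeasure K.haarMeas) - μ‖ < ε}

/-- `M_ss(G,K)`. -/
def ssCosetMeas [LocallyCompactSpace G] (K : CompactSubgroup G) : Set (RadonMeasure 𝕜 G) :=
  cosetMeas 𝕜 K ∩ ssMeas 𝕜 G K.cosetChar

/-- `M_ai(G,K)`. -/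
def aiCosetMeas [LocallyCompactSpace G] (K : CompactSubgroup G) : Set (RadonMeasure 𝕜 G) :=
  cosetMeas 𝕜 K ∩ aiMeas 𝕜 G K.cosetChar

variable {𝕜}

/-- `S` is a norm closed linear subspace of `M(G)`. -/
def IsClosedSubspace (S : Set (RadonMeasure 𝕜 G)) : Prop :=
  IsClosed S ∧ ∃ V : Submodule 𝕜 (RadonMeasure 𝕜 G), (V : Set (RadonMeasure 𝕜 G)) = S

/-- `S` is a norm closed two-sided ideal of the convolution algebra `M(G)`. -/
def IsClosedIdeal [LocallyCompactSpace G] (S : Set (RadonMeasure 𝕜 G)) : Prop :=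
  IsClosedSubspace S ∧ ∀ μ ∈ S, ∀ ν : RadonMeasure 𝕜 G, conv μ ν ∈ S ∧ conv ν μ ∈ S

/-- `S` is a linear subspace such that `μ ∈ S` and `|ν| ≪ |μ|` imply `ν ∈ S`. -/
def IsLSubspace (S : Set (RadonMeasure 𝕜 G)) : Prop :=
  (∃ V : Submodule 𝕜 (RadonMeasure 𝕜 G), (V : Set (RadonMeasure 𝕜 G)) = S) ∧
    ∀ μ ∈ S, ∀ ν : RadonMeasure 𝕜 G, ν.tv ≪ μ.tv → ν ∈ S

/-- `S` is closed under taking absolute values. -/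
def IsAbsClosed (S : Set (RadonMeasure 𝕜 G)) : Prop := ∀ μ ∈ S, absVal μ ∈ S

/-- `S = A ⊕ B` as linear spaces. -/
def IsDirectSum (S A B : Set (RadonMeasure 𝕜 G)) : Prop :=
  ∃ U V W : Submodule 𝕜 (RadonMeasure 𝕜 G),
    (U : Set (RadonMeasure 𝕜 G)) = A ∧ (V : Set (RadonMeasure 𝕜 G)) = B ∧
      (W : Set (RadonMeasure 𝕜 G)) = S ∧ U ⊔ V = W ∧ Disjoint U V

/-- `A ⟂ B`: every measure in `A` is singular to every measure in `B`. -/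
def SetSingular (A B : Set (RadonMeasure 𝕜 G)) : Prop :=
  ∀ μ ∈ A, ∀ ν ∈ B, μ.tv ⟂ₘ ν.tv

end Classes

end RadonConv

open RadonConv

set_option linter.unusedSectionVars false

/-! Characters and convolution equations are first translated into conditions on sets. By
compactness, for infinite τ one has χ(G/K) ≤ τ exactly when K is an intersection of at most τ open
sets (`cosetChar_le_iff`). Moreover μ ⋆ λ_K = μ exactly when μ is invariant under right translation
by K (`cosetMeas_eq_rightInv`); this rests on Fubini's theorem for convolutions
(`posConv_eq_posConvSwap`).

Compact subgroups that are intersections of at most τ open sets are stable under countable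
intersections, so M_τ(G) is a norm closed subspace. It is solid because continuous compactly
supported densities are dense in L¹(|μ|) and their groups of right periods are G_δ sets
(`isSolid_charSubmodule`). Convolving on the left preserves right invariance. Convolving on the
right replaces K by an intersection of conjugates over a σ-compact set carrying the other factor,
and by compactness this is again an intersection of at most τ open sets (`conv_mem_charMeas_right`).

A closed solid subspace N is a band: every μ is the sum of a restriction in N and a restriction
singular to N (`IsSolid.exists_restr_mem`). The approximately invariant measures form such an N,
which is moreover an ideal: it is M_a(G) if τ = ℵ₀, and the closure of the measures of smaller
character otherwise (`aiMeas_eq_closure`). In both cases the strongly singular measures are the part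
of M_τ(G) singular to N, which gives (i) and (ii). For (iii), the ideal N is stable under right
translation, so uniqueness of the splitting makes both parts of a right K-invariant measure right
K-invariant (`mem_rightInv_of_decomposition`). -/

namespace RadonConv

/-! ### Fubini's theorem for convolutions of finite regular measures -/

section Fubini

variable {G : Type*} [Group G] [TopologicalSpace G] [IsTopologicalGroup G]
  [MeasurableSpace G] [BorelSpace G]

/-- Convolution of positive measures with the order of integration reversed. -/
noncomputable def posConvSwap (m n : Measure G) : Measure G :=
  (posConv (n.map (Homeomorph.inv G)) (m.map (Homeomorph.inv G))).map (Homeomorph.inv G)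

theorem map_inv_preimage_mul (m : Measure G) {E : Set G} (hE : MeasurableSet E) (y : G) :
    (m.map (Homeomorph.inv G)) ((y⁻¹ * ·) ⁻¹' (Homeomorph.inv G ⁻¹' E)) = m ((· * y) ⁻¹' E) := by
  have hi : Measurable (Homeomorph.inv G) := (Homeomorph.inv G).continuous.measurable
  rw [Measure.map_apply hi ((continuous_const_mul _).measurable (hi hE))]
  congr 1
  ext x
  simp

theorem measurable_preimage_mul_right (m : Measure G) [IsFiniteMeasure m] [m.Regular]
    {E : Set G} (hE : MeasurableSet E) : Measurable fun y : G => m ((· * y) ⁻¹' E) := by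
  have hi : Measurable (Homeomorph.inv G) := (Homeomorph.inv G).continuous.measurable
  have : (m.map (Homeomorph.inv G)).Regular := Measure.Regular.map _
  have : IsFiniteMeasure (m.map (Homeomorph.inv G)) := Measure.isFiniteMeasure_map _ _
  have h := (measurable_preimage_mul (m.map (Homeomorph.inv G)) (hi hE)).comp hi
  convert h using 2 with y
  exact (map_inv_preimage_mul m hE y).symm

theorem posConvSwap_apply (m n : Measure G) [IsFiniteMeasure m] [m.Regular]
    {E : Set G} (hE : MeasurableSet E) :
    posConvSwap m n E = ∫⁻ y, m ((· * y) ⁻¹' E) ∂n := by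
  have hi : Measurable (Homeomorph.inv G) := (Homeomorph.inv G).continuous.measurable
  have : (m.map (Homeomorph.inv G)).Regular := Measure.Regular.map _
  have : IsFiniteMeasure (m.map (Homeomorph.inv G)) := Measure.isFiniteMeasure_map _ _
  rw [posConvSwap, Measure.map_apply hi hE, posConv_apply _ _ (hi hE),
    lintegral_map (measurable_preimage_mul _ (hi hE)) hi]
  exact lintegral_congr fun y => map_inv_preimage_mul m hE y

theorem measurable_map_mul_left (n : Measure G) [IsFiniteMeasure n] [n.Regular] :
    Measurable fun x : G => n.map (x * ·) := by
  refine Measure.measurable_of_measurable_coe _ fun s hs => ?_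
  simp_rw [Measure.map_apply (continuous_const_mul _).measurable hs]
  exact measurable_preimage_mul n hs

theorem measurable_map_mul_right (m : Measure G) [IsFiniteMeasure m] [m.Regular] :
    Measurable fun y : G => m.map (· * y) := by
  refine Measure.measurable_of_measurable_coe _ fun s hs => ?_
  simp_rw [Measure.map_apply (continuous_mul_const _).measurable hs]
  exact measurable_preimage_mul_right m hs

theorem measurable_lintegral_mul_left (n : Measure G) [IsFiniteMeasure n] [n.Regular]
    {f : G → ℝ≥0∞} (hf : Measurable f) : Measurable fun x : G => ∫⁻ y, f (x * y) ∂n := by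
  simp_rw [← lintegral_map hf (continuous_const_mul _).measurable]
  exact (Measure.measurable_lintegral hf).comp (measurable_map_mul_left n)

theorem measurable_lintegral_mul_right (m : Measure G) [IsFiniteMeasure m] [m.Regular]
    {f : G → ℝ≥0∞} (hf : Measurable f) : Measurable fun y : G => ∫⁻ x, f (x * y) ∂m := by
  simp_rw [← lintegral_map hf (continuous_mul_const _).measurable]
  exact (Measure.measurable_lintegral hf).comp (measurable_map_mul_right m)

theorem lintegral_posConv (m n : Measure G) [IsFiniteMeasure n] [n.Regular]
    {f : G → ℝ≥0∞} (hf : Measurable f) :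
    ∫⁻ z, f z ∂posConv m n = ∫⁻ x, ∫⁻ y, f (x * y) ∂n ∂m := by
  rw [posConv, Measure.lintegral_bind (measurable_map_mul_left n).aemeasurable hf.aemeasurable]
  exact lintegral_congr fun x => lintegral_map hf (continuous_const_mul x).measurable

theorem lintegral_posConvSwap (m n : Measure G) [IsFiniteMeasure m] [m.Regular]
    {f : G → ℝ≥0∞} (hf : Measurable f) :
    ∫⁻ z, f z ∂posConvSwap m n = ∫⁻ y, ∫⁻ x, f (x * y) ∂m ∂n := by
  have hi : Measurable (Homeomorph.inv G) := (Homeomorph.inv G).continuous.measurable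
  have : (m.map (Homeomorph.inv G)).Regular := Measure.Regular.map _
  have : IsFiniteMeasure (m.map (Homeomorph.inv G)) := Measure.isFiniteMeasure_map _ _
  have hfi := hf.comp hi
  rw [posConvSwap, lintegral_map hf hi]
  refine (lintegral_posConv _ _ hfi).trans ?_
  rw [lintegral_map (measurable_lintegral_mul_left _ hfi) hi]
  refine lintegral_congr fun y => ?_
  refine (lintegral_map (f := fun z => (f ∘ Homeomorph.inv G) (Homeomorph.inv G y * z))
    (hfi.comp (continuous_const_mul _).measurable) hi).trans ?_
  simp

variable [LocallyCompactSpace G]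

/-- The function F(xy) need not have compact support on G × G. Multiplying it by cutoffs that equal
1 on C and D changes no integral and makes the support compact, so the interchange for continuous
compactly supported functions applies. That interchange does not require multiplication to be
measurable for the product σ-algebra. -/
theorem lintegral_lintegral_mul_swap_of_compact (m n : Measure G) [IsFiniteMeasure m]
    [IsFiniteMeasure n] [m.Regular] [n.Regular] {C D : Set G} (hC : IsCompact C) (hD : IsCompact D)
    (hm : m Cᶜ = 0) (hn : n Dᶜ = 0) {F : G → ℝ} (hF : Continuous F) (hFs : HasCompactSupport F)
    (hF0 : 0 ≤ F) :
    ∫⁻ x, ∫⁻ y, ENNReal.ofReal (F (x * y)) ∂n ∂m =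
      ∫⁻ y, ∫⁻ x, ENNReal.ofReal (F (x * y)) ∂m ∂n := by
  obtain ⟨B, hB⟩ := hF.bounded_above_of_compact_support hFs
  obtain ⟨g, hg1, -, hgs, hg⟩ := exists_continuous_one_zero_of_isCompact hC isClosed_empty
    (disjoint_empty C)
  obtain ⟨h, hh1, -, hhs, hh⟩ := exists_continuous_one_zero_of_isCompact hD isClosed_empty
    (disjoint_empty D)
  have hmC : ∀ᵐ x ∂m, x ∈ C := hm
  have hnD : ∀ᵐ x ∂n, x ∈ D := hn
  have hcut : HasCompactSupport (Function.uncurry fun x y => F (x * y) * (g x * h y)) := by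
    refine HasCompactSupport.intro (K := tsupport g ×ˢ tsupport h) (hgs.prod hhs) ?_
    rintro ⟨x, y⟩ hxy
    simp only [mem_prod, not_and_or] at hxy
    rcases hxy with h' | h'
    · simp [image_eq_zero_of_notMem_tsupport h']
    · simp [image_eq_zero_of_notMem_tsupport h']
  have hcont : Continuous (Function.uncurry fun x y => F (x * y) * (g x * h y)) := by
    simp only [Function.uncurry_def]
    fun_prop
  have hswap := integral_integral_swap_of_hasCompactSupport (μ := m) (ν := n) hcont hcut
  have e1 : ∫ x, ∫ y, F (x * y) * (g x * h y) ∂n ∂m = ∫ x, ∫ y, F (x * y) ∂n ∂m := by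
    refine integral_congr_ae ?_
    filter_upwards [hmC] with x hx
    refine integral_congr_ae ?_
    filter_upwards [hnD] with y hy
    simp [hg1 hx, hh1 hy]
  have e2 : ∫ y, ∫ x, F (x * y) * (g x * h y) ∂m ∂n = ∫ y, ∫ x, F (x * y) ∂m ∂n := by
    refine integral_congr_ae ?_
    filter_upwards [hnD] with x hx
    refine integral_congr_ae ?_
    filter_upwards [hmC] with y hy
    simp [hg1 hy, hh1 hx]
  rw [e1, e2] at hswap
  have i1 : ∀ x, Integrable (fun y => F (x * y)) n := fun x =>
    Integrable.of_bound (hF.comp (continuous_const_mul x)).measurable.aestronglyMeasurable B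
      (ae_of_all _ fun y => hB _)
  have i2 : ∀ y, Integrable (fun x => F (x * y)) m := fun x =>
    Integrable.of_bound (hF.comp (continuous_mul_const x)).measurable.aestronglyMeasurable B
      (ae_of_all _ fun y => hB _)
  have hFm : Measurable fun x => ENNReal.ofReal (F x) := hF.measurable.ennreal_ofReal
  have hB' : ∀ z, ENNReal.ofReal (F z) ≤ ENNReal.ofReal B := fun z =>
    ENNReal.ofReal_le_ofReal ((le_abs_self _).trans (hB z))
  have hF0 : ∀ x, 0 ≤ F x := hF0
  have k1 : ∀ x, ENNReal.ofReal (∫ y, F (x * y) ∂n) = ∫⁻ y, ENNReal.ofReal (F (x * y)) ∂n :=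
    fun x => ofReal_integral_eq_lintegral_ofReal (i1 x) (ae_of_all _ fun y => hF0 _)
  have k2 : ∀ y, ENNReal.ofReal (∫ x, F (x * y) ∂m) = ∫⁻ x, ENNReal.ofReal (F (x * y)) ∂m :=
    fun y => ofReal_integral_eq_lintegral_ofReal (i2 y) (ae_of_all _ fun x => hF0 _)
  have l1 : ∀ x, ∫ y, F (x * y) ∂n = (∫⁻ y, ENNReal.ofReal (F (x * y)) ∂n).toReal := fun x => by
    rw [← k1, ENNReal.toReal_ofReal (integral_nonneg fun y => hF0 _)]
  have l2 : ∀ y, ∫ x, F (x * y) ∂m = (∫⁻ x, ENNReal.ofReal (F (x * y)) ∂m).toReal := fun x => by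
    rw [← k2, ENNReal.toReal_ofReal (integral_nonneg fun y => hF0 _)]
  rw [integral_eq_lintegral_of_nonneg_ae (ae_of_all _ fun x => integral_nonneg fun y => hF0 _) (by
      simp_rw [l1]
      exact (measurable_lintegral_mul_left n hFm).ennreal_toReal.aestronglyMeasurable),
    integral_eq_lintegral_of_nonneg_ae (ae_of_all _ fun x => integral_nonneg fun y => hF0 _) (by
      simp_rw [l2]
      exact (measurable_lintegral_mul_right m hFm).ennreal_toReal.aestronglyMeasurable)] at hswap
  simp_rw [k1, k2] at hswap
  refine (ENNReal.toReal_eq_toReal_iff' ?_ ?_).mp hswap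
  · refine ne_top_of_le_ne_top ?_ (lintegral_mono fun x => lintegral_mono fun y => hB' (x * y))
    simp only [lintegral_const]
    finiteness
  · refine ne_top_of_le_ne_top ?_ (lintegral_mono fun x => lintegral_mono fun y => hB' (y * x))
    simp only [lintegral_const]
    finiteness

variable [T2Space G]

theorem regular_posConvSwap (m n : Measure G) [IsFiniteMeasure m] [IsFiniteMeasure n]
    [m.Regular] [n.Regular] : (posConvSwap m n).Regular := by
  have : (m.map (Homeomorph.inv G)).Regular := Measure.Regular.map _
  have : IsFiniteMeasure (m.map (Homeomorph.inv G)) := Measure.isFiniteMeasure_map _ _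
  have : (n.map (Homeomorph.inv G)).Regular := Measure.Regular.map _
  have : IsFiniteMeasure (n.map (Homeomorph.inv G)) := Measure.isFiniteMeasure_map _ _
  have := regular_posConv (n.map (Homeomorph.inv G)) (m.map (Homeomorph.inv G))
  exact Measure.Regular.map _

/-- Both sides are regular, hence determined by their integrals of continuous compactly supported
functions. -/
theorem posConv_eq_posConvSwap_of_compact (m n : Measure G) [IsFiniteMeasure m]
    [IsFiniteMeasure n] [m.Regular] [n.Regular] {C D : Set G} (hC : IsCompact C)
    (hD : IsCompact D) (hm : m Cᶜ = 0) (hn : n Dᶜ = 0) : posConv m n = posConvSwap m n := by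
  have := regular_posConv m n
  have := regular_posConvSwap m n
  have := isFiniteMeasure_posConv m n
  refine Measure.ext_of_integral_eq_on_compactlySupported_nnreal fun f => ?_
  have hf : Continuous fun x => (f x : ℝ) := by fun_prop
  have hfs : HasCompactSupport fun x => (f x : ℝ) :=
    f.hasCompactSupport.comp_left (g := fun x : ℝ≥0 => (x : ℝ)) rfl
  have hm : Measurable fun x => ENNReal.ofReal (f x : ℝ) := hf.measurable.ennreal_ofReal
  rw [integral_eq_lintegral_of_nonneg_ae (f := fun x => (f x : ℝ)) (ae_of_all _ fun x => (f x).2)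
      hf.measurable.aestronglyMeasurable,
    integral_eq_lintegral_of_nonneg_ae (f := fun x => (f x : ℝ)) (ae_of_all _ fun x => (f x).2)
      hf.measurable.aestronglyMeasurable, lintegral_posConv m n hm, lintegral_posConvSwap m n hm,
    lintegral_lintegral_mul_swap_of_compact m n hC hD ‹_› hn hf hfs fun x => (f x).2]

/-- Fubini's theorem for the convolution of finite regular measures. -/
theorem posConv_eq_posConvSwap (m n : Measure G) [IsFiniteMeasure m]
    [IsFiniteMeasure n] [m.Regular] [n.Regular] : posConv m n = posConvSwap m n := by
  ext E hE
  -- The left side of the inequality bounds the error made in either iterated integral when m and n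
  -- are restricted to C and D.
  have key : ∀ ε : ℝ≥0, 0 < ε → ∃ C D : Set G, IsCompact C ∧ IsCompact D ∧
      m Cᶜ * n univ + m univ * n Dᶜ ≤ ε := by
    intro ε hε
    obtain ⟨δ, h0, hlt⟩ := ENNReal.exists_nnreal_pos_mul_lt
      (a := m univ + n univ) (b := ε) (by finiteness) (by exact_mod_cast hε.ne')
    obtain ⟨C, -, hC, hC'⟩ := MeasurableSet.univ.exists_isCompact_sdiff_lt
      (measure_ne_top m univ) (ε := (δ : ℝ≥0∞)) (by exact_mod_cast h0.ne')
    obtain ⟨D, -, hD, hD'⟩ := MeasurableSet.univ.exists_isCompact_sdiff_lt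
      (measure_ne_top n univ) (ε := (δ : ℝ≥0∞)) (by exact_mod_cast h0.ne')
    rw [← compl_eq_univ_sdiff] at hC' hD'
    refine ⟨C, D, hC, hD, le_trans ?_ hlt.le⟩
    calc m Cᶜ * n univ + m univ * n Dᶜ ≤ δ * n univ + m univ * δ := by gcongr
      _ = δ * (m univ + n univ) := by ring
  have hcut : ∀ (p : Measure G) {D A : Set G}, MeasurableSet D → MeasurableSet A →
      p A ≤ p.restrict D A + p Dᶜ := fun p D A hD hA => by
    rw [Measure.restrict_apply hA]
    refine (measure_mono fun x hx => ?_).trans (measure_union_le _ _)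
    by_cases h : x ∈ D
    · exact Or.inl ⟨hx, h⟩
    · exact Or.inr h
  have hl := fun x : G => (continuous_const_mul x).measurable hE
  have hr := fun x : G => (continuous_mul_const x).measurable hE
  refine le_antisymm (ENNReal.le_of_forall_pos_le_add fun ε hε _ => ?_)
    (ENNReal.le_of_forall_pos_le_add fun ε hε _ => ?_)
  all_goals
    obtain ⟨C, D, hC, hD, hCD⟩ := key ε hε
    have := regular_of_le (Measure.restrict_le_self (μ := m) (s := C))
    have := regular_of_le (Measure.restrict_le_self (μ := n) (s := D))
    have hCm := hC.measurableSet
    have hDm := hD.measurableSet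
    have heq := congrArg (fun p : Measure G => p E) <|
      posConv_eq_posConvSwap_of_compact (m.restrict C) (n.restrict D) hC hD
        (by simp [Measure.restrict_apply hCm.compl]) (by simp [Measure.restrict_apply hDm.compl])
    simp only [posConv_apply _ _ hE, posConvSwap_apply _ _ hE] at heq ⊢
  · calc ∫⁻ x, n ((x * ·) ⁻¹' E) ∂m
        = ∫⁻ x in C, n ((x * ·) ⁻¹' E) ∂m + ∫⁻ x in Cᶜ, n ((x * ·) ⁻¹' E) ∂m :=
          (lintegral_add_compl _ hCm).symm
      _ ≤ ∫⁻ x in C, (n.restrict D ((x * ·) ⁻¹' E) + n Dᶜ) ∂m + ∫⁻ x in Cᶜ, n univ ∂m := by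
          gcongr with x
          · exact hcut n hDm (hl x)
          · exact subset_univ _
      _ ≤ (∫⁻ x in C, n.restrict D ((x * ·) ⁻¹' E) ∂m + m univ * n Dᶜ) + m Cᶜ * n univ := by
          rw [lintegral_add_left (measurable_preimage_mul _ hE), lintegral_const, lintegral_const,
            Measure.restrict_apply_univ, Measure.restrict_apply_univ, mul_comm (n univ),
            mul_comm (n Dᶜ)]
          gcongr
          exact subset_univ _
      _ = ∫⁻ y in D, m.restrict C ((· * y) ⁻¹' E) ∂n + (m Cᶜ * n univ + m univ * n Dᶜ) := by
          rw [heq]; ring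
      _ ≤ ∫⁻ y, m ((· * y) ⁻¹' E) ∂n + ε := by
          gcongr <;> exact Measure.restrict_le_self
  · calc ∫⁻ y, m ((· * y) ⁻¹' E) ∂n
        = ∫⁻ y in D, m ((· * y) ⁻¹' E) ∂n + ∫⁻ y in Dᶜ, m ((· * y) ⁻¹' E) ∂n :=
          (lintegral_add_compl _ hDm).symm
      _ ≤ ∫⁻ y in D, (m.restrict C ((· * y) ⁻¹' E) + m Cᶜ) ∂n + ∫⁻ y in Dᶜ, m univ ∂n := by
          gcongr with y
          · exact hcut m hCm (hr y)
          · exact subset_univ _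
      _ ≤ (∫⁻ y in D, m.restrict C ((· * y) ⁻¹' E) ∂n + m Cᶜ * n univ) + m univ * n Dᶜ := by
          rw [lintegral_add_left (measurable_preimage_mul_right _ hE), lintegral_const,
            lintegral_const, Measure.restrict_apply_univ, Measure.restrict_apply_univ]
          gcongr
          exact subset_univ _
      _ = ∫⁻ x in C, n.restrict D ((x * ·) ⁻¹' E) ∂m + (m Cᶜ * n univ + m univ * n Dᶜ) := by
          rw [heq]; ring
      _ ≤ ∫⁻ x, n ((x * ·) ⁻¹' E) ∂m + ε := by
          gcongr <;> exact Measure.restrict_le_self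

theorem posConv_apply_right (m n : Measure G) [IsFiniteMeasure m] [IsFiniteMeasure n]
    [m.Regular] [n.Regular] {E : Set G} (hE : MeasurableSet E) :
    posConv m n E = ∫⁻ y, m ((· * y) ⁻¹' E) ∂n := by
  rw [posConv_eq_posConvSwap, posConvSwap_apply m n hE]

end Fubini
end RadonConv

namespace RadonConv

/-! ### Radon–Nikodym densities of scalar-valued measures -/

section Density

variable {𝕜 : Type*} [RCLike 𝕜] {X : Type*} [MeasurableSpace X]

theorem eq_zero_of_variation_eq_zero {ν : VectorMeasure X 𝕜} {E : Set X}
    (h : ν.variation E = 0) : ν E = 0 := by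
  have := VectorMeasure.enorm_measure_le_variation ν E
  rw [h] at this
  simpa using this

/-- The Radon–Nikodym theorem for signed measures is applied to the real and imaginary parts, which
vanish on m-null sets because the variation does. -/
theorem exists_density {ν : VectorMeasure X 𝕜} {m : Measure X} [IsFiniteMeasure m]
    (h : ν.variation ≪ m) : ∃ f : X → 𝕜, Integrable f m ∧ m.withDensityᵥ f = ν := by
  have key : ∀ L : 𝕜 →+ ℝ, ∀ hL : Continuous L, ∃ a : X → ℝ, Integrable a m ∧
      m.withDensityᵥ a = ν.mapRange L hL := by
    intro L hL
    refine ⟨_, SignedMeasure.integrable_rnDeriv (ν.mapRange L hL) m,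
      SignedMeasure.withDensityᵥ_rnDeriv_eq _ m ?_⟩
    refine VectorMeasure.AbsolutelyContinuous.mk fun E hE hE0 => ?_
    rw [Measure.toENNRealVectorMeasure_apply_measurable hE] at hE0
    rw [VectorMeasure.mapRange_apply, eq_zero_of_variation_eq_zero (h hE0), map_zero]
  obtain ⟨a, ha, ha'⟩ := key (RCLike.re (K := 𝕜)) RCLike.continuous_re
  obtain ⟨b, hb, hb'⟩ := key (RCLike.im (K := 𝕜)) RCLike.continuous_im
  have ha2 : Integrable (fun x => (a x : 𝕜)) m := ha.ofReal
  have hb2 : Integrable (fun x => (b x : 𝕜) * RCLike.I) m := hb.ofReal.mul_const _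
  refine ⟨fun x => (a x : 𝕜) + (b x : 𝕜) * RCLike.I, ha2.add hb2, ?_⟩
  ext E hE
  have h1 : ∫ x in E, a x ∂m = RCLike.re (ν E) := by
    rw [← withDensityᵥ_apply ha hE, ha']
    exact VectorMeasure.mapRange_apply _ _
  have h2 : ∫ x in E, b x ∂m = RCLike.im (ν E) := by
    rw [← withDensityᵥ_apply hb hE, hb']
    exact VectorMeasure.mapRange_apply _ _
  refine (withDensityᵥ_apply (ha2.add hb2) hE).trans ?_
  simp only [Pi.add_apply]
  rw [integral_add ha2.integrableOn hb2.integrableOn,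
    integral_mul_const, integral_ofReal, integral_ofReal, h1, h2, RCLike.re_add_im]

/-- The identity is clear for simple functions. Bounded simple approximations carry it over by
dominated convergence on both sides, since the variation |h|m is finite. -/
theorem integral_withDensityᵥ_mul {m : Measure X} {h : X → 𝕜} (hh : Integrable h m)
    {φ : X → 𝕜} (hφ : StronglyMeasurable φ) {C : ℝ} (hC0 : 0 ≤ C)
    (hC : ∀ x, ‖φ x‖ ≤ C) :
    ∫ᵛ x, φ x ∂[ContinuousLinearMap.mul ℝ 𝕜; m.withDensityᵥ h] = ∫ x, φ x * h x ∂m := by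
  have hvar : (m.withDensityᵥ h).variation = m.withDensity fun x => ‖h x‖ₑ :=
    Measure.variation_withDensityᵥ hh
  have hfin : IsFiniteMeasure (m.withDensityᵥ h).variation := by
    rw [hvar]
    exact isFiniteMeasure_withDensity hh.2.ne
  have hbd : ∀ (s : SimpleFunc X 𝕜), ∃ B, ∀ x, ‖s x‖ ≤ B := fun s =>
    s.exists_forall_norm_le
  have hint : ∀ s : SimpleFunc X 𝕜, (m.withDensityᵥ h).Integrable s := fun s => by
    obtain ⟨B, hB⟩ := hbd s
    exact Integrable.of_bound (μ := (m.withDensityᵥ h).variation)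
      s.stronglyMeasurable.aestronglyMeasurable B (ae_of_all _ hB)
  have hint' : ∀ s : SimpleFunc X 𝕜, Integrable (fun x => s x * h x) m := fun s => by
    obtain ⟨B, hB⟩ := hbd s
    exact hh.bdd_mul s.stronglyMeasurable.aestronglyMeasurable (ae_of_all _ hB)
  have hs : ∀ s : SimpleFunc X 𝕜,
      ∫ᵛ x, s x ∂[ContinuousLinearMap.mul ℝ 𝕜; m.withDensityᵥ h] = ∫ x, s x * h x ∂m := by
    intro s
    induction s using SimpleFunc.induction with
    | const c hs =>
      rename_i s
      have e : (⇑(SimpleFunc.piecewise s hs (SimpleFunc.const X c) (SimpleFunc.const X 0))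
        : X → 𝕜) = s.indicator fun _ => c := by
        ext x; by_cases hx : x ∈ s <;> simp [hx]
      rw [e, VectorMeasure.integral_indicator hs, VectorMeasure.integral_const]
      have e2 : (fun x => s.indicator (fun _ => c) x * h x) = s.indicator fun x => c * h x := by
        ext x; by_cases hx : x ∈ s <;> simp [hx]
      rw [e2, integral_indicator hs, integral_const_mul, ← withDensityᵥ_apply hh hs]
      simp
    | add hd hf hg =>
      rename_i f g
      simp only [SimpleFunc.coe_add, Pi.add_apply, add_mul]
      rw [integral_add (hint' f) (hint' g), ← hf, ← hg,
        ← VectorMeasure.integral_fun_add (hint f) (hint g)]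
  have hlim : ∀ x, Tendsto (fun n => hφ.approxBounded C n x) atTop (𝓝 (φ x)) := fun x =>
    hφ.tendsto_approxBounded_of_norm_le (hC x)
  have hfirst : Tendsto (fun n => ∫ᵛ x, hφ.approxBounded C n x
      ∂[ContinuousLinearMap.mul ℝ 𝕜; m.withDensityᵥ h]) atTop
      (𝓝 (∫ᵛ x, φ x ∂[ContinuousLinearMap.mul ℝ 𝕜; m.withDensityᵥ h])) :=
    VectorMeasure.tendsto_integral_of_dominated_convergence (fun _ => C)
      (fun n => (hφ.approxBounded C n).stronglyMeasurable.aestronglyMeasurable)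
      (integrable_const _) (fun n => ae_of_all _ fun x => hφ.norm_approxBounded_le hC0 n x)
      (ae_of_all _ hlim)
  refine tendsto_nhds_unique hfirst ?_
  simp_rw [hs]
  refine tendsto_integral_of_dominated_convergence (fun x => C * ‖h x‖)
    (fun n => (hint' _).1) (hh.norm.const_mul C) (fun n => ae_of_all _ fun x => ?_)
    (ae_of_all _ fun x => (hlim x).mul_const _)
  rw [norm_mul]
  gcongr
  exact hφ.norm_approxBounded_le hC0 n x

end Density

/-! ### Total variation and restriction of Radon measures -/

namespace RadonMeasure

variable {𝕜 : Type*} [RCLike 𝕜] {G : Type*} [TopologicalSpace G] [T2Space G]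
  [MeasurableSpace G] [BorelSpace G]

@[ext] theorem ext {μ ν : RadonMeasure 𝕜 G}
    (h : ∀ E, MeasurableSet E → μ.1 E = ν.1 E) : μ = ν :=
  Subtype.ext (VectorMeasure.ext h)

theorem tv_zero : (0 : RadonMeasure 𝕜 G).tv = 0 := VectorMeasure.variation_zero

theorem tv_eq_zero {μ : RadonMeasure 𝕜 G} (h : μ.tv = 0) : μ = 0 :=
  Subtype.ext (VectorMeasure.variation_eq_zero.mp h)

theorem tv_add_le (μ ν : RadonMeasure 𝕜 G) : (μ + ν).tv ≤ μ.tv + ν.tv :=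
  VectorMeasure.variation_add_le

theorem tv_smul_absolutelyContinuous (c : 𝕜) (μ : RadonMeasure 𝕜 G) : (c • μ).tv ≪ μ.tv := by
  have : (c • μ).tv = ‖c‖₊ • μ.tv := VectorMeasure.variation_smul
  rw [this]
  exact Measure.smul_absolutelyContinuous

theorem enorm_apply_le (μ : RadonMeasure 𝕜 G) (E : Set G) : ‖μ.1 E‖ₑ ≤ μ.tv E :=
  VectorMeasure.enorm_measure_le_variation _ _

theorem norm_apply_le (μ : RadonMeasure 𝕜 G) (E : Set G) : ‖μ.1 E‖ ≤ ‖μ‖ := by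
  have : IsFiniteMeasure μ.1.variation := μ.2.1
  exact (VectorMeasure.norm_measure_le_variation (measure_ne_top _ _)).trans
    (measureReal_mono (μ := μ.tv) (subset_univ _))

theorem tv_le_of_forall {μ : RadonMeasure 𝕜 G} {m : Measure G}
    (h : ∀ E, MeasurableSet E → ‖μ.1 E‖ₑ ≤ m E) : μ.tv ≤ m :=
  VectorMeasure.variation_le_of_forall_enorm_le h

theorem enorm_eq_tv (μ : RadonMeasure 𝕜 G) : ‖μ‖ₑ = μ.tv univ := by
  rw [← ofReal_norm, norm_def, ofReal_measureReal]

theorem tv_apply_le_enorm (μ : RadonMeasure 𝕜 G) (E : Set G) : μ.tv E ≤ ‖μ‖ₑ := by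
  rw [enorm_eq_tv]
  exact measure_mono (subset_univ _)

theorem tv_le_add_enorm_sub (μ ν : RadonMeasure 𝕜 G) (E : Set G) :
    μ.tv E ≤ ν.tv E + ‖μ - ν‖ₑ := by
  calc μ.tv E = ((μ - ν) + ν).tv E := by rw [sub_add_cancel]
    _ ≤ (μ - ν).tv E + ν.tv E := tv_add_le _ _ E
    _ ≤ ‖μ - ν‖ₑ + ν.tv E := by gcongr; exact tv_apply_le_enorm _ _
    _ = _ := add_comm _ _

theorem tv_ofMeasure (m : Measure G) [IsFiniteMeasure m] [m.Regular] :
    (ofMeasure m : RadonMeasure 𝕜 G).tv = m := by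
  refine le_antisymm (tv_le_of_forall fun E hE => ?_) (Measure.le_iff.mpr fun E hE => ?_)
  · rw [ofMeasure_apply m hE, ← ofReal_norm, RCLike.norm_ofReal, abs_of_nonneg measureReal_nonneg,
      ofReal_measureReal]
  · refine le_trans (le_of_eq ?_) (enorm_apply_le _ E)
    rw [ofMeasure_apply m hE, ← ofReal_norm, RCLike.norm_ofReal, abs_of_nonneg measureReal_nonneg,
      ofReal_measureReal]

theorem tv_absVal (μ : RadonMeasure 𝕜 G) : (absVal μ).tv = μ.tv := tv_ofMeasure _

/-- The restriction of a bounded Radon measure to a set. -/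
noncomputable def restr (μ : RadonMeasure 𝕜 G) (A : Set G) : RadonMeasure 𝕜 G :=
  ⟨μ.1.restrict A, by
    have h : (μ.1.restrict A).variation ≤ μ.tv :=
      VectorMeasure.variation_restrict_le.trans Measure.restrict_le_self
    exact ⟨isFiniteMeasure_of_le _ h, regular_of_le h⟩⟩

theorem tv_restr (μ : RadonMeasure 𝕜 G) {A : Set G} (hA : MeasurableSet A) :
    (μ.restr A).tv = μ.tv.restrict A := VectorMeasure.variation_restrict hA

theorem restr_apply (μ : RadonMeasure 𝕜 G) {A E : Set G} (hA : MeasurableSet A)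
    (hE : MeasurableSet E) : (μ.restr A).1 E = μ.1 (E ∩ A) :=
  VectorMeasure.restrict_apply _ hA hE

theorem restr_add_restr_diff (μ : RadonMeasure 𝕜 G) {A B : Set G} (hA : MeasurableSet A)
    (hB : MeasurableSet B) (hAB : A ⊆ B) : μ.restr A + μ.restr (B \ A) = μ.restr B := by
  ext E hE
  change (μ.restr A).1 E + (μ.restr (B \ A)).1 E = _
  rw [restr_apply _ hA hE, restr_apply _ (hB.diff hA) hE, restr_apply _ hB hE,
    ← VectorMeasure.of_union _ (hE.inter hA) (hE.inter (hB.diff hA)), ← inter_union_distrib_left,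
    union_sdiff_cancel hAB]
  exact disjoint_sdiff_self_right.mono inter_subset_right inter_subset_right

theorem restr_univ (μ : RadonMeasure 𝕜 G) : μ.restr univ = μ := by
  ext E hE
  rw [restr_apply _ MeasurableSet.univ hE, inter_univ]

theorem restr_add_restr_compl (μ : RadonMeasure 𝕜 G) {A : Set G} (hA : MeasurableSet A) :
    μ.restr A + μ.restr Aᶜ = μ := by
  rw [compl_eq_univ_sdiff, restr_add_restr_diff μ hA MeasurableSet.univ (subset_univ _), restr_univ]

theorem norm_sub_restr (μ : RadonMeasure 𝕜 G) {A B : Set G} (hA : MeasurableSet A)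
    (hB : MeasurableSet B) (hAB : A ⊆ B) : ‖μ.restr B - μ.restr A‖ₑ = μ.tv (B \ A) := by
  rw [← restr_add_restr_diff μ hA hB hAB, add_sub_cancel_left, enorm_eq_tv,
    tv_restr _ (hB.diff hA), Measure.restrict_apply_univ]

/-- A Radon measure given by a density whose total variation is dominated by a Radon measure. -/
theorem exists_eq_withDensityᵥ {m : Measure G} {n : Measure G} [IsFiniteMeasure n] [n.Regular]
    {f : G → 𝕜} (hf : Integrable f m) (h : (m.withDensity fun x => ‖f x‖ₑ) ≤ n) :
    ∃ μ : RadonMeasure 𝕜 G, μ.1 = m.withDensityᵥ f := by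
  have h' : (m.withDensityᵥ f).variation ≤ n := by rwa [Measure.variation_withDensityᵥ hf]
  exact ⟨⟨_, isFiniteMeasure_of_le _ h', regular_of_le h'⟩, rfl⟩

theorem norm_sub_withDensityᵥ {μ ν : RadonMeasure 𝕜 G} {m : Measure G} {f g : G → 𝕜}
    (hf : Integrable f m) (hg : Integrable g m) (hμ : μ.1 = m.withDensityᵥ f)
    (hν : ν.1 = m.withDensityᵥ g) : ‖μ - ν‖ₑ = ∫⁻ x, ‖f x - g x‖ₑ ∂m := by
  have : (μ - ν).1 = m.withDensityᵥ (f - g) := by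
    rw [withDensityᵥ_sub hf hg, ← hμ, ← hν]; rfl
  rw [enorm_eq_tv, tv, this, Measure.variation_withDensityᵥ (hf.sub hg),
    withDensity_apply _ MeasurableSet.univ]
  simp

end RadonMeasure
end RadonConv

namespace RadonConv

open RadonMeasure

/-! ### Right invariance and convolution with λ_K -/

section Convolution

variable {𝕜 : Type*} [RCLike 𝕜] {G : Type*} [Group G] [TopologicalSpace G] [IsTopologicalGroup G]
  [T2Space G] [LocallyCompactSpace G] [MeasurableSpace G] [BorelSpace G]

theorem measurableSet_preimage_mul_right {E : Set G} (hE : MeasurableSet E) (k : G) :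
    MeasurableSet ((· * k) ⁻¹' E) := (continuous_mul_const k).measurable hE

theorem measurableSet_preimage_mul_left {E : Set G} (hE : MeasurableSet E) (k : G) :
    MeasurableSet ((k * ·) ⁻¹' E) := (continuous_const_mul k).measurable hE

theorem tv_conv_le (μ ν : RadonMeasure 𝕜 G) : (conv μ ν).tv ≤ posConv μ.tv ν.tv :=
  tv_le_of_forall fun E hE => by
    rw [conv_apply μ ν hE]
    exact enorm_convFun_le μ ν hE

theorem enorm_conv_le (μ ν : RadonMeasure 𝕜 G) : ‖conv μ ν‖ₑ ≤ ‖μ‖ₑ * ‖ν‖ₑ := by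
  rw [enorm_eq_tv, enorm_eq_tv, enorm_eq_tv]
  refine (tv_conv_le μ ν univ).trans ?_
  rw [posConv_apply _ _ MeasurableSet.univ]
  simp [mul_comm]

theorem conv_sub_left (μ μ' ν : RadonMeasure 𝕜 G) :
    conv (μ - μ') ν = conv μ ν - conv μ' ν := by
  ext E hE
  change _ = (conv μ ν).1 E - (conv μ' ν).1 E
  rw [conv_apply _ _ hE, conv_apply _ _ hE, conv_apply _ _ hE]
  exact VectorMeasure.integral_sub_vectorMeasure (integrable_preimage_mul μ ν hE)
    (integrable_preimage_mul μ' ν hE)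

theorem conv_sub_right (μ ν ν' : RadonMeasure 𝕜 G) :
    conv μ (ν - ν') = conv μ ν - conv μ ν' := by
  ext E hE
  change _ = (conv μ ν).1 E - (conv μ ν').1 E
  rw [conv_apply _ _ hE, conv_apply _ _ hE, conv_apply _ _ hE]
  exact VectorMeasure.integral_fun_sub (integrable_preimage_mul μ ν hE)
    (integrable_preimage_mul μ ν' hE)

variable (𝕜) in
/-- The measures that are invariant under right translation by the elements of `S`. -/
def rightInv (S : Set G) : Submodule 𝕜 (RadonMeasure 𝕜 G) where
  carrier := {μ | ∀ k ∈ S, ∀ E, MeasurableSet E → μ.1 ((· * k) ⁻¹' E) = μ.1 E}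
  zero_mem' := fun k _ E _ => rfl
  add_mem' := fun {μ ν} hμ hν k hk E hE => by
    change μ.1 _ + ν.1 _ = μ.1 _ + ν.1 _
    rw [hμ k hk E hE, hν k hk E hE]
  smul_mem' := fun c μ hμ k hk E hE => by
    change c • μ.1 _ = c • μ.1 _
    rw [hμ k hk E hE]

theorem rightInv_anti {S T : Set G} (h : S ⊆ T) : rightInv 𝕜 T ≤ rightInv 𝕜 S :=
  fun _ hμ k hk => hμ k (h hk)

theorem continuous_apply (E : Set G) : Continuous fun μ : RadonMeasure 𝕜 G => μ.1 E := by
  refine continuous_iff_continuousAt.mpr fun μ => ?_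
  rw [ContinuousAt, tendsto_iff_norm_sub_tendsto_zero]
  refine squeeze_zero (fun _ => norm_nonneg _) (fun ν => norm_apply_le (ν - μ) E) ?_
  exact tendsto_iff_norm_sub_tendsto_zero.mp tendsto_id

theorem isClosed_rightInv (S : Set G) : IsClosed (rightInv 𝕜 S : Set (RadonMeasure 𝕜 G)) := by
  have : (rightInv 𝕜 S : Set (RadonMeasure 𝕜 G)) = ⋂ k ∈ S, ⋂ E : Set G, ⋂ _ : MeasurableSet E,
      {μ | μ.1 ((· * k) ⁻¹' E) = μ.1 E} := by
    ext μ
    simp only [mem_iInter]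
    exact Iff.rfl
  rw [this]
  exact isClosed_biInter fun k _ => isClosed_iInter fun E => isClosed_iInter fun _ =>
    isClosed_eq (continuous_apply _) (continuous_apply _)

theorem map_mul_right_eq {μ : RadonMeasure 𝕜 G} {S : Set G} (hμ : μ ∈ rightInv 𝕜 S) {k : G}
    (hk : k ∈ S) : μ.1.map (· * k) = μ.1 := by
  ext E hE
  rw [VectorMeasure.map_apply _ (continuous_mul_const k).measurable hE]
  exact hμ k hk E hE

theorem variation_map_mul_right (ν : VectorMeasure G 𝕜) (k : G) :
    (ν.map (· * k)).variation = ν.variation.map (· * k) :=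
  MeasurableEmbedding.variation_map (Homeomorph.mulRight k).measurableEmbedding

theorem tv_map_mul_right {μ : RadonMeasure 𝕜 G} {S : Set G} (hμ : μ ∈ rightInv 𝕜 S) {k : G}
    (hk : k ∈ S) : μ.tv.map (· * k) = μ.tv := by
  rw [tv, ← variation_map_mul_right, map_mul_right_eq hμ hk]

theorem ofMeasure_mem_rightInv {m : Measure G} [IsFiniteMeasure m] [m.Regular] {S : Set G}
    (h : ∀ k ∈ S, m.map (· * k) = m) : ofMeasure m ∈ rightInv 𝕜 S := fun k hk E hE => by
  rw [ofMeasure_apply m hE, ofMeasure_apply m (measurableSet_preimage_mul_right hE k)]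
  conv_rhs => rw [← h k hk]
  rw [measureReal_def, measureReal_def, Measure.map_apply (continuous_mul_const k).measurable hE]

theorem absVal_mem_rightInv {μ : RadonMeasure 𝕜 G} {S : Set G} (hμ : μ ∈ rightInv 𝕜 S) :
    absVal μ ∈ rightInv 𝕜 S :=
  ofMeasure_mem_rightInv fun _ hk => tv_map_mul_right hμ hk

theorem conv_mem_rightInv (μ : RadonMeasure 𝕜 G) {ν : RadonMeasure 𝕜 G} {S : Set G}
    (hν : ν ∈ rightInv 𝕜 S) : conv μ ν ∈ rightInv 𝕜 S := fun k hk E hE => by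
  rw [conv_apply _ _ hE, conv_apply _ _ (measurableSet_preimage_mul_right hE k)]
  congr 1
  ext x
  rw [← hν k hk _ (measurableSet_preimage_mul_left hE x)]
  congr 1
  ext y
  simp [mul_assoc]

/-- Haar measure on K is left invariant by construction. Its right translates are again left
invariant, hence multiples of it, and the total mass forces the factor 1. -/
theorem haarMeas_map_mul_right (K : CompactSubgroup G) {k : G} (hk : k ∈ K.1) :
    K.haarMeas.map (· * k) = K.haarMeas := by
  rw [CompactSubgroup.haarMeas, Measure.map_map (continuous_mul_const k).measurable
    measurable_subtype_coe]
  have : ((· * k) ∘ (Subtype.val : K.1 → G)) = Subtype.val ∘ (· * (⟨k, hk⟩ : K.1)) := rfl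
  rw [this, ← Measure.map_map measurable_subtype_coe (continuous_mul_const _).measurable]
  congr 1
  set m := Measure.haarMeasure (⊤ : TopologicalSpace.PositiveCompacts K.1)
  have hu : m univ = 1 := Measure.haarMeasure_self (K₀ := (⊤ : TopologicalSpace.PositiveCompacts K.1))
  have hf : IsFiniteMeasure (m.map (· * (⟨k, hk⟩ : K.1))) := Measure.isFiniteMeasure_map _ _
  have h := Measure.isMulInvariant_eq_smul_of_compactSpace (m.map (· * (⟨k, hk⟩ : K.1))) m
  have hc := congrArg (fun p : Measure K.1 => p univ) h
  simp only [Measure.map_apply (continuous_mul_const _).measurable MeasurableSet.univ,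
    preimage_univ, Measure.smul_apply, hu] at hc
  rw [h]
  have hc' : Measure.haarScalarFactor (m.map (· * (⟨k, hk⟩ : K.1))) m = 1 := by
    simpa [ENNReal.smul_def, eq_comm] using hc
  rw [hc', one_smul]

theorem haarMeas_compl (K : CompactSubgroup G) : K.haarMeas (K.1 : Set G)ᶜ = 0 := by
  rw [CompactSubgroup.haarMeas, Measure.map_apply measurable_subtype_coe
    K.2.measurableSet.compl]
  have : (Subtype.val : K.1 → G) ⁻¹' (K.1 : Set G)ᶜ = ∅ := by
    ext x
    simp
  rw [this, measure_empty]

/-- By Fubini the convolution is the average over K of the right translates of n, each of which is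
n. -/
theorem posConv_haarMeas {K : CompactSubgroup G} {n : Measure G} [IsFiniteMeasure n] [n.Regular]
    (hn : ∀ k ∈ K.1, n.map (· * k) = n) : posConv n K.haarMeas = n := by
  ext E hE
  rw [posConv_apply_right _ _ hE]
  have hK : ∀ᵐ y ∂K.haarMeas, y ∈ K.1 := haarMeas_compl K
  calc ∫⁻ y, n ((· * y) ⁻¹' E) ∂K.haarMeas = ∫⁻ _, n E ∂K.haarMeas := by
        refine lintegral_congr_ae ?_
        filter_upwards [hK] with y hy
        conv_rhs => rw [← hn y hy]
        rw [Measure.map_apply (continuous_mul_const y).measurable hE]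
    _ = n E := by simp

/-- This reduces to positive measures. Write μ = h|μ|. Since μ and |μ| are both right K-invariant,
so is h up to null sets, and the positive and negative parts of Re h and Im h are densities of
positive K-invariant measures, to which `posConv_haarMeas` applies. -/
theorem conv_haarMeas_of_mem {K : CompactSubgroup G} {μ : RadonMeasure 𝕜 G}
    (hμ : μ ∈ rightInv 𝕜 (K.1 : Set G)) : conv μ (ofMeasure K.haarMeas) = μ := by
  have hmr := fun k : G => (continuous_mul_const k).measurable
  obtain ⟨h, hh, hhμ⟩ := exists_density (ν := μ.1) (m := μ.tv) Measure.AbsolutelyContinuous.rfl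
  have hnorm : (μ.tv.withDensity fun x => ‖h x‖ₑ) = μ.tv := by
    rw [← Measure.variation_withDensityᵥ hh, hhμ]; rfl
  -- The function h(· k) is also a density of μ with respect to |μ|, and densities are unique almost
  -- everywhere. The exceptional null set may depend on k.
  have hinv : ∀ k ∈ K.1, ∀ᵐ x ∂μ.tv, h (x * k) = h x := by
    intro k hk
    have hmap := tv_map_mul_right hμ hk
    have hme : MeasurableEmbedding fun x : G => x * k :=
      (Homeomorph.mulRight k).measurableEmbedding
    have hk' : Integrable (fun x => h (x * k)) μ.tv := by
      have := hh
      rw [← hmap] at this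
      exact (hme.integrable_map_iff.mp this)
    refine hk'.ae_eq_of_withDensityᵥ_eq hh ?_
    refine Eq.trans ?_ hhμ.symm
    rw [← map_mul_right_eq hμ (k := k⁻¹) (inv_mem hk)]
    ext E hE
    have hE' := measurableSet_preimage_mul_right hE k⁻¹
    rw [VectorMeasure.map_apply _ (hmr _) hE, withDensityᵥ_apply hk' hE, ← hhμ,
      withDensityᵥ_apply hh hE']
    conv_rhs => rw [← hmap]
    rw [hme.setIntegral_map]
    congr 2
    ext x
    simp
  -- Here b will be ±Re h or ±Im h, and `ENNReal.ofReal` selects its positive part. The bound by ‖h‖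
  -- makes the measure with that density at most |h||μ| = |μ|, hence finite and regular.
  have hpos : ∀ b : G → ℝ, Integrable b μ.tv → (∀ x, |b x| ≤ ‖h x‖) →
      (∀ k ∈ K.1, ∀ᵐ x ∂μ.tv, b (x * k) = b x) → ∀ E, MeasurableSet E →
      ∫⁻ x, ENNReal.ofReal (K.haarMeas.real ((x * ·) ⁻¹' E) * b x) ∂μ.tv =
        ∫⁻ x in E, ENNReal.ofReal (b x) ∂μ.tv := by
    intro b hb hbh hbk E hE
    set n := μ.tv.withDensity fun x => ENNReal.ofReal (b x) with hn
    have hle : n ≤ μ.tv := by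
      conv_rhs => rw [← hnorm]
      refine withDensity_mono (ae_of_all _ fun x => ?_)
      simp only
      rw [← ofReal_norm]
      exact ENNReal.ofReal_le_ofReal ((le_abs_self _).trans (hbh x))
    have := isFiniteMeasure_of_le _ hle
    have := regular_of_le hle
    have hnk : ∀ k ∈ K.1, n.map (· * k) = n := by
      intro k hk
      ext A hA
      rw [Measure.map_apply (hmr k) hA, hn, withDensity_apply _ hA,
        withDensity_apply _ (hmr k hA)]
      conv_rhs => rw [← tv_map_mul_right hμ hk]
      have hme : MeasurableEmbedding fun x : G => x * k :=
        (Homeomorph.mulRight k).measurableEmbedding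
      rw [hme.restrict_map, hme.lintegral_map]
      refine lintegral_congr_ae (ae_restrict_of_ae ?_)
      filter_upwards [hbk k hk] with x hx
      rw [hx]
    have h1 := posConv_haarMeas hnk
    have h2 : posConv n K.haarMeas E = n E := by rw [h1]
    rw [posConv_apply _ _ hE, hn, withDensity_apply _ hE,
      lintegral_withDensity_eq_lintegral_mul₀ hb.1.aemeasurable.ennreal_ofReal
        (measurable_preimage_mul _ hE).aemeasurable] at h2
    rw [← h2]
    refine lintegral_congr fun x => ?_
    rw [ENNReal.ofReal_mul measureReal_nonneg, ofReal_measureReal, mul_comm, Pi.mul_apply]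
  have hreal : ∀ b : G → ℝ, Integrable b μ.tv → (∀ x, |b x| ≤ ‖h x‖) →
      (∀ k ∈ K.1, ∀ᵐ x ∂μ.tv, b (x * k) = b x) → ∀ E, MeasurableSet E →
      ∫ x, K.haarMeas.real ((x * ·) ⁻¹' E) * b x ∂μ.tv = ∫ x in E, b x ∂μ.tv := by
    intro b hb hbh hbk E hE
    have hi : Integrable (fun x => K.haarMeas.real ((x * ·) ⁻¹' E) * b x) μ.tv :=
      hb.bdd_mul (c := 1) (measurable_preimage_mul _ hE).ennreal_toReal.aestronglyMeasurable
        (ae_of_all _ fun x => by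
          rw [Real.norm_of_nonneg measureReal_nonneg]
          exact measureReal_le_one)
    rw [integral_eq_lintegral_pos_part_sub_lintegral_neg_part hi,
      integral_eq_lintegral_pos_part_sub_lintegral_neg_part hb.integrableOn,
      hpos b hb hbh hbk E hE]
    have h' := hpos (fun x => -b x) hb.neg (fun x => by rw [abs_neg]; exact hbh x)
      (fun k hk => (hbk k hk).mono fun x hx => by rw [hx]) E hE
    simp only [mul_neg] at h'
    rw [h']
  ext E hE
  rw [conv_apply _ _ hE, ← hhμ, integral_withDensityᵥ_mul hh
    (measurable_vector_preimage_mul _ hE).stronglyMeasurable (norm_nonneg _)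
    (fun x => norm_apply_le _ _), withDensityᵥ_apply hh hE]
  simp_rw [ofMeasure_apply K.haarMeas (measurableSet_preimage_mul_left hE _)]
  have hi : Integrable (fun x => ((K.haarMeas.real ((x * ·) ⁻¹' E) : ℝ) : 𝕜) * h x) μ.tv :=
    hh.bdd_mul (c := 1)
      (RCLike.continuous_ofReal.measurable.comp
        (measurable_preimage_mul _ hE).ennreal_toReal).aestronglyMeasurable
      (ae_of_all _ fun x => by
        rw [RCLike.norm_ofReal, abs_of_nonneg measureReal_nonneg]
        exact measureReal_le_one)
  have hh' : IntegrableOn h E μ.tv := hh.integrableOn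
  refine RCLike.ext ?_ ?_
  · rw [← integral_re hi, ← integral_re hh']
    simp_rw [RCLike.re_ofReal_mul]
    exact hreal _ hh.re (fun x => RCLike.abs_re_le_norm _)
      (fun k hk => (hinv k hk).mono fun x hx => by rw [hx]) E hE
  · rw [← integral_im hi, ← integral_im hh']
    simp_rw [RCLike.im_ofReal_mul]
    exact hreal _ hh.im (fun x => RCLike.abs_im_le_norm _)
      (fun k hk => (hinv k hk).mono fun x hx => by rw [hx]) E hE

/-- A convolution inherits right invariance from its right factor λ_K; the other inclusion is
`conv_haarMeas_of_mem`. In this form the condition visibly passes to smaller subgroups, to norm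
limits and to the total variation. -/
theorem cosetMeas_eq_rightInv (K : CompactSubgroup G) :
    cosetMeas 𝕜 K = rightInv 𝕜 (K.1 : Set G) := by
  refine Set.Subset.antisymm (fun μ hμ => ?_) fun μ hμ => conv_haarMeas_of_mem hμ
  have hμ : conv μ (ofMeasure K.haarMeas) = μ := hμ
  rw [← hμ]
  exact conv_mem_rightInv _ (ofMeasure_mem_rightInv fun k hk => haarMeas_map_mul_right K hk)

theorem enorm_conv_haarMeas_le (μ : RadonMeasure 𝕜 G) (K : CompactSubgroup G) :
    ‖conv μ (ofMeasure K.haarMeas)‖ₑ ≤ ‖μ‖ₑ := by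
  refine (enorm_conv_le _ _).trans (le_of_eq ?_)
  rw [enorm_eq_tv (ofMeasure K.haarMeas), tv_ofMeasure, measure_univ, mul_one]

/-- Right translation of bounded Radon measures. -/
noncomputable def rightTranslate (k : G) (μ : RadonMeasure 𝕜 G) : RadonMeasure 𝕜 G :=
  ⟨μ.1.map (· * k), by
    have h : (μ.1.map (· * k)).variation = μ.tv.map (Homeomorph.mulRight k) :=
      variation_map_mul_right _ _
    change IsFiniteMeasure (μ.1.map (· * k)).variation ∧ (μ.1.map (· * k)).variation.Regular
    rw [h]
    exact ⟨Measure.isFiniteMeasure_map _ _, Measure.Regular.map _⟩⟩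

theorem rightTranslate_apply (k : G) (μ : RadonMeasure 𝕜 G) {E : Set G} (hE : MeasurableSet E) :
    (rightTranslate k μ).1 E = μ.1 ((· * k) ⁻¹' E) :=
  VectorMeasure.map_apply _ (continuous_mul_const k).measurable hE

theorem tv_rightTranslate (k : G) (μ : RadonMeasure 𝕜 G) :
    (rightTranslate k μ).tv = μ.tv.map (· * k) := variation_map_mul_right _ _

/-- The measure δ is the point mass at k. As a consequence, ideals of M(G) are stable under right
translation. -/
theorem exists_conv_eq_rightTranslate (k : G) :
    ∃ δ : RadonMeasure 𝕜 G, ∀ μ : RadonMeasure 𝕜 G, conv μ δ = rightTranslate k μ := by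
  have hreg : (Measure.dirac k : Measure G).Regular := by
    refine regular_of_open_approx _ fun U hU ε hε => ?_
    by_cases hk : k ∈ U
    · refine ⟨{k}, by simpa using hk, isCompact_singleton, ?_⟩
      simp [hk]
    · exact ⟨∅, empty_subset _, isCompact_empty, by simp [hU.measurableSet, hk]⟩
  refine ⟨ofMeasure (Measure.dirac k), fun μ => ?_⟩
  ext E hE
  rw [conv_apply _ _ hE, rightTranslate_apply k μ hE]
  have hE' := measurableSet_preimage_mul_right hE k
  have : IsFiniteMeasure μ.1.variation := μ.2.1
  have h1 : (fun x : G => (ofMeasure (Measure.dirac k) : RadonMeasure 𝕜 G).1 ((x * ·) ⁻¹' E)) =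
      ((· * k) ⁻¹' E).indicator fun _ => (1 : 𝕜) := by
    funext x
    rw [ofMeasure_apply _ (measurableSet_preimage_mul_left hE x), measureReal_def,
      Measure.dirac_apply' _ (measurableSet_preimage_mul_left hE x)]
    by_cases hx : x * k ∈ E <;> simp [hx]
  rw [h1, VectorMeasure.integral_indicator hE', VectorMeasure.integral_const]
  simp

end Convolution
end RadonConv

namespace RadonConv

/-! ### The character of G/K and intersections of open sets -/

section Character

open scoped Pointwise

universe u

variable {G : Type u} [TopologicalSpace G]

/-- `S` is the intersection of at most `τ` open sets. -/
def IsOpenInter (τ : Cardinal.{u}) (S : Set G) : Prop :=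
  ∃ 𝒰 : Set (Set G), #𝒰 ≤ τ ∧ (∀ U ∈ 𝒰, IsOpen U) ∧ ⋂₀ 𝒰 = S

theorem IsOpenInter.mono {τ τ' : Cardinal.{u}} {S : Set G} (h : IsOpenInter τ S) (hτ : τ ≤ τ') :
    IsOpenInter τ' S := by
  obtain ⟨𝒰, h1, h2, h3⟩ := h
  exact ⟨𝒰, h1.trans hτ, h2, h3⟩

theorem isOpenInter_iInter {τ : Cardinal.{u}} (hτ : ℵ₀ ≤ τ)
    {S : ℕ → Set G} (h : ∀ i, IsOpenInter τ (S i)) : IsOpenInter τ (⋂ i, S i) := by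
  choose 𝒰 h1 h2 h3 using h
  refine ⟨⋃ i, 𝒰 i, ?_, ?_, ?_⟩
  · have hle := Cardinal.mk_iUnion_le_lift 𝒰
    rw [Cardinal.lift_uzero, Cardinal.mk_nat, Cardinal.lift_aleph0] at hle
    refine hle.trans (Cardinal.mul_le_of_le hτ hτ (ciSup_le' fun i => ?_))
    rw [Cardinal.lift_uzero]
    exact h1 i
  · rintro U ⟨_, ⟨i, rfl⟩, hU⟩
    exact h2 i U hU
  · rw [sInter_iUnion]
    simp [h3]

theorem IsOpenInter.inter {τ : Cardinal.{u}} (hτ : ℵ₀ ≤ τ) {S T : Set G} (hS : IsOpenInter τ S)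
    (hT : IsOpenInter τ T) : IsOpenInter τ (S ∩ T) := by
  obtain ⟨𝒰, h1, h2, rfl⟩ := hS
  obtain ⟨𝒱, h1', h2', rfl⟩ := hT
  refine ⟨𝒰 ∪ 𝒱, (Cardinal.mk_union_le _ _).trans (Cardinal.add_le_of_le hτ h1 h1'), ?_,
    sInter_union _ _⟩
  rintro U (hU | hU)
  exacts [h2 U hU, h2' U hU]

theorem isOpenInter_nat {S : ℕ → Set G} (h : ∀ n, IsOpen (S n)) : IsOpenInter ℵ₀ (⋂ n, S n) :=
  ⟨range S, by simpa using (countable_range S).le_aleph0, by rintro _ ⟨n, rfl⟩; exact h n,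
    sInter_range S⟩

theorem exists_localWeight_basis {X : Type*} [TopologicalSpace X] (x : X) :
    ∃ B : Set (Set X), (𝓝 x).HasBasis (fun s => s ∈ B) id ∧ #B = localWeight x :=
  csInf_mem (s := {c | ∃ B : Set (Set X), (𝓝 x).HasBasis (fun s => s ∈ B) id ∧ #B = c})
    ⟨_, {s | s ∈ 𝓝 x}, (𝓝 x).basis_sets, rfl⟩

variable [Group G] [IsTopologicalGroup G] [T2Space G]

/-- As K is closed, G/K is a T₁ space, so the preimages of a neighbourhood base at the base point
intersect exactly in K. Passing to interiors loses nothing, because each preimage is a neighbourhood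
of every point of K. -/
theorem isOpenInter_of_cosetChar_le {τ : Cardinal.{u}} {K : CompactSubgroup G}
    (h : K.cosetChar ≤ τ) : IsOpenInter τ (K.1 : Set G) := by
  obtain ⟨B, hB, hc⟩ := exists_localWeight_basis ((1 : G) : G ⧸ K.1)
  have : IsClosed (K.1 : Set G) := K.2.isClosed
  have hT1 : T1Space (G ⧸ K.1) := inferInstance
  refine ⟨(fun s => interior ((QuotientGroup.mk : G → G ⧸ K.1) ⁻¹' s)) '' B,
    Cardinal.mk_image_le.trans (hc.trans_le h), ?_, ?_⟩
  · rintro _ ⟨s, -, rfl⟩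
    exact isOpen_interior
  · ext x
    simp only [sInter_image, mem_iInter, SetLike.mem_coe]
    refine ⟨fun hx => ?_, fun hx s hs => ?_⟩
    · by_contra hxK
      have hne : ((1 : G) : G ⧸ K.1) ≠ (x : G ⧸ K.1) := by
        rw [Ne, QuotientGroup.eq]
        simpa using hxK
      obtain ⟨s, hs, hsx⟩ := hB.mem_iff.mp (isOpen_compl_singleton.mem_nhds hne)
      exact hsx (interior_subset (s := (QuotientGroup.mk : G → G ⧸ K.1) ⁻¹' s) (hx s hs)) rfl
    · have hx1 : (x : G ⧸ K.1) = ((1 : G) : G ⧸ K.1) := by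
        rw [eq_comm, QuotientGroup.eq]
        simpa using hx
      rw [mem_interior_iff_mem_nhds]
      refine continuous_quotient_mk'.continuousAt.preimage_mem_nhds ?_
      change s ∈ 𝓝 (x : G ⧸ K.1)
      rw [hx1]
      exact hB.mem_of_mem hs

/-- Each of the open sets is shrunk to a compact neighbourhood of K. Finite intersections of these,
cut down by one compact W, form a directed family of compact sets whose intersection lies in K. Any
neighbourhood of K therefore contains one of them, and their images form a neighbourhood base in
G/K. -/
theorem cosetChar_le_of_isOpenInter [LocallyCompactSpace G] {τ : Cardinal.{u}} (hτ : ℵ₀ ≤ τ)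
    {K : CompactSubgroup G} (h : IsOpenInter τ (K.1 : Set G)) : K.cosetChar ≤ τ := by
  classical
  obtain ⟨𝒰, hc, hopen, hinter⟩ := h
  have hex : ∀ U : 𝒰, ∃ V : Set G, IsCompact V ∧ (K.1 : Set G) ⊆ interior V ∧ V ⊆ U := fun U =>
    exists_compact_between K.2 (hopen U U.2) (by rw [← hinter]; exact sInter_subset_of_mem U.2)
  choose V hVc hKV hVU using hex
  obtain ⟨W, hWc, hKW⟩ := exists_compact_superset K.2
  let A : Finset 𝒰 → Set G := fun F => W ∩ ⋂ U ∈ F, V U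
  have hA : ∀ F, A F ∈ 𝓝 (1 : G) := fun F =>
    inter_mem (mem_interior_iff_mem_nhds.mp (hKW K.1.one_mem))
      ((Filter.biInter_finset_mem F).mpr fun U _ =>
        mem_interior_iff_mem_nhds.mp (hKV U K.1.one_mem))
  have hAc : ∀ F, IsCompact (A F) := fun F =>
    hWc.inter_right (isClosed_biInter fun U _ => (hVc U).isClosed)
  have hdir : Directed (· ⊇ ·) A := fun F F' =>
    ⟨F ∪ F', inter_subset_inter_right _ (biInter_subset_biInter_left (by simp)),
      inter_subset_inter_right _ (biInter_subset_biInter_left (by simp))⟩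
  have hAK : ⋂ F, A F ⊆ K.1 := by
    rw [← hinter]
    intro x hx U hU
    have := (mem_iInter.mp hx {⟨U, hU⟩}).2
    exact hVU ⟨U, hU⟩ (by simpa using this)
  let B : Set (Set (G ⧸ K.1)) := range fun F => (QuotientGroup.mk : G → G ⧸ K.1) '' A F
  have hB : (𝓝 ((1 : G) : G ⧸ K.1)).HasBasis (fun s => s ∈ B) id := by
    refine ⟨fun t => ⟨fun ht => ?_, ?_⟩⟩
    · have hN : ∀ x ∈ ⋂ F, A F, (QuotientGroup.mk : G → G ⧸ K.1) ⁻¹' t ∈ 𝓝 x := fun x hx => by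
        have hx1 : (x : G ⧸ K.1) = ((1 : G) : G ⧸ K.1) := by
          rw [eq_comm, QuotientGroup.eq]
          simpa using hAK hx
        refine continuous_quotient_mk'.continuousAt.preimage_mem_nhds ?_
        change t ∈ 𝓝 (x : G ⧸ K.1)
        rwa [hx1]
      obtain ⟨F, hF⟩ := exists_subset_nhds_of_isCompact hdir hAc hN
      exact ⟨_, ⟨F, rfl⟩, image_subset_iff.mpr hF⟩
    · rintro ⟨_, ⟨F, rfl⟩, hF⟩
      refine mem_of_superset ?_ hF
      exact QuotientGroup.isOpenMap_coe.image_mem_nhds (hA F)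
  have hle : K.cosetChar ≤ #B := csInf_le' ⟨B, hB, rfl⟩
  refine hle.trans ?_
  refine Cardinal.mk_range_le.trans ?_
  -- The base is indexed by the finite subsets of 𝒰: finitely many if 𝒰 is finite, which is where ℵ₀
  -- ≤ τ enters, and as many as the elements of 𝒰 otherwise.
  rcases finite_or_infinite 𝒰 with hfin | hinf
  · exact (Cardinal.mk_le_aleph0).trans hτ
  · rw [Cardinal.mk_finset_of_infinite]
    exact hc

theorem cosetChar_le_iff [LocallyCompactSpace G] {τ : Cardinal.{u}} (hτ : ℵ₀ ≤ τ)
    {K : CompactSubgroup G} : K.cosetChar ≤ τ ↔ IsOpenInter τ (K.1 : Set G) :=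
  ⟨isOpenInter_of_cosetChar_le, cosetChar_le_of_isOpenInter hτ⟩

/-- With a finite character, K would be a finite intersection of open sets, hence open. -/
theorem aleph0_le_cosetChar {K : CompactSubgroup G} (hK : ¬ IsOpen (K.1 : Set G)) :
    ℵ₀ ≤ K.cosetChar := by
  by_contra h
  rw [not_le] at h
  obtain ⟨𝒰, hc, hopen, hinter⟩ := isOpenInter_of_cosetChar_le (le_refl K.cosetChar)
  refine hK ?_
  rw [← hinter]
  exact (Cardinal.lt_aleph0_iff_set_finite.mp (hc.trans_lt h)).isOpen_sInter hopen

/-- The intersection of the conjugates `x K x⁻¹` over the elements `x` of a σ-compact set. -/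
theorem exists_le_conj {τ : Cardinal.{u}} (hτ : ℵ₀ ≤ τ) {K : CompactSubgroup G}
    (hK : IsOpenInter τ (K.1 : Set G)) {C : ℕ → Set G} (hC : ∀ n, IsCompact (C n)) :
    ∃ L : CompactSubgroup G, IsOpenInter τ (L.1 : Set G) ∧ L.1 ≤ K.1 ∧
      ∀ n, ∀ x ∈ C n, ∀ k ∈ L.1, x * k * x⁻¹ ∈ K.1 := by
  let L : Subgroup G :=
    { carrier := (K.1 : Set G) ∩ ⋂ n, ⋂ x ∈ C n, {k | x * k * x⁻¹ ∈ K.1}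
      one_mem' := by simp [K.1.one_mem]
      mul_mem' := by
        rintro a b ⟨ha, ha'⟩ ⟨hb, hb'⟩
        simp only [mem_iInter, mem_ofPred_eq, mem_inter_iff] at ha' hb' ⊢
        refine ⟨K.1.mul_mem ha hb, fun n x hx => ?_⟩
        have := K.1.mul_mem (ha' n x hx) (hb' n x hx)
        simpa [mul_assoc] using this
      inv_mem' := by
        rintro a ⟨ha, ha'⟩
        simp only [mem_iInter, mem_ofPred_eq, mem_inter_iff] at ha' ⊢
        refine ⟨K.1.inv_mem ha, fun n x hx => ?_⟩
        have := K.1.inv_mem (ha' n x hx)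
        simpa [mul_assoc] using this }
  have hcl : IsClosed (⋂ n, ⋂ x ∈ C n, {k | x * k * x⁻¹ ∈ K.1}) :=
    isClosed_iInter fun n => isClosed_biInter fun x _ =>
      K.2.isClosed.preimage (by fun_prop : Continuous fun k : G => x * k * x⁻¹)
  refine ⟨⟨L, K.2.inter_right hcl⟩, ?_, fun x hx => hx.1, fun n x hx k hk => ?_⟩
  · refine hK.inter hτ (isOpenInter_iInter hτ fun n => ?_)
    obtain ⟨𝒰, hc, hopen, hinter⟩ := hK
    -- Since `C n` is compact, demanding x k x⁻¹ ∈ U for all x in it is an open condition on k. One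
    -- open set per U therefore suffices, however many conjugates are intersected.
    refine ⟨(fun U => {k | ∀ x ∈ C n, x * k * x⁻¹ ∈ U}) '' 𝒰, Cardinal.mk_image_le.trans hc, ?_, ?_⟩
    · rintro _ ⟨U, hU, rfl⟩
      refine isOpen_iff_mem_nhds.mpr fun k hk => ?_
      refine (hC n).eventually_forall_of_forall_eventually fun x hx => ?_
      have hcont : Continuous fun z : G × G => z.2 * z.1 * z.2⁻¹ := by fun_prop
      exact (hcont.tendsto (k, x)).eventually ((hopen U hU).mem_nhds (hk x hx))
    · ext k
      have : ∀ y, y ∈ K.1 ↔ ∀ U ∈ 𝒰, y ∈ U := fun y => by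
        rw [← SetLike.mem_coe, ← hinter, mem_sInter]
      simp only [sInter_image, mem_iInter, mem_ofPred_eq, this]
      exact ⟨fun h x hx U hU => h U hU x hx, fun h U hU x hx => h x hx U hU⟩
  · have := hk.2
    simp only [mem_iInter] at this
    exact this n x hx

/-- The group of right periods of a function. -/
def rightPeriods {F : Type*} (f : G → F) : Subgroup G where
  carrier := {k | ∀ x, f (x * k) = f x}
  one_mem' := by simp
  mul_mem' := fun {a b} ha hb x => by rw [← mul_assoc, hb, ha]
  inv_mem' := fun {a} ha x => by
    have := ha (x * a⁻¹)
    simpa using this.symm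

theorem isClosed_rightPeriods {F : Type*} [TopologicalSpace F] [T2Space F] {f : G → F}
    (hf : Continuous f) : IsClosed (rightPeriods f : Set G) := by
  have : (rightPeriods f : Set G) = ⋂ x, {k | f (x * k) = f x} := by
    ext k
    simp only [mem_iInter]
    exact Iff.rfl
  rw [this]
  exact isClosed_iInter fun x =>
    isClosed_eq (hf.comp (continuous_const_mul x)) continuous_const

/-- A continuous compactly supported f is uniformly continuous: near a period k the supremum of
‖f(xz) - f(x)‖ over x is small. So each of the countably many sets of 1/(n+1)-periods contains all
periods in its interior. -/
theorem isOpenInter_rightPeriods {F : Type*} [NormedAddCommGroup F] [LocallyCompactSpace G]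
    {f : G → F} (hf : Continuous f) (hfs : HasCompactSupport f) :
    IsOpenInter ℵ₀ (rightPeriods f : Set G) := by
  have : (rightPeriods f : Set G) =
      ⋂ n : ℕ, interior {k | ∀ x, ‖f (x * k) - f x‖ < 1 / ((n : ℝ) + 1)} := by
    ext k
    simp only [mem_iInter]
    refine ⟨fun hk n => ?_, fun hk x => ?_⟩
    · have hk : ∀ x, f (x * k) = f x := hk
      rw [mem_interior_iff_mem_nhds]
      obtain ⟨N, hN, hkN⟩ := exists_compact_mem_nhds k
      -- For z ∈ N and x outside this compact set both f(x) and f(xz) vanish, so only x in this set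
      -- has to be controlled.
      have hS : IsCompact (tsupport f ∪ tsupport f * N⁻¹) := hfs.union (hfs.mul hN.inv)
      have hpos : (0 : ℝ) < 1 / ((n : ℝ) + 1) := by positivity
      have : ∀ᶠ z in 𝓝 k, ∀ x ∈ tsupport f ∪ tsupport f * N⁻¹,
          ‖f (x * z) - f x‖ < 1 / ((n : ℝ) + 1) := by
        refine hS.eventually_forall_of_forall_eventually fun x _ => ?_
        have hcont : Continuous fun z : G × G => ‖f (z.2 * z.1) - f z.2‖ := by fun_prop
        refine (hcont.tendsto (k, x)).eventually (gt_mem_nhds ?_)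
        simpa [hk x] using hpos
      filter_upwards [this, hkN] with z hz hzN x
      by_cases hx : x ∈ tsupport f ∪ tsupport f * N⁻¹
      · exact hz x hx
      · simp only [mem_union, not_or] at hx
        have h2 : x * z ∉ tsupport f := fun h =>
          hx.2 ⟨x * z, h, z⁻¹, inv_mem_inv.mpr hzN, by simp⟩
        rwa [image_eq_zero_of_notMem_tsupport hx.1, image_eq_zero_of_notMem_tsupport h2, sub_zero,
          norm_zero]
    · rw [← sub_eq_zero, ← norm_eq_zero]
      refine le_antisymm (le_of_forall_gt fun ε hε => ?_) (norm_nonneg _)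
      obtain ⟨n, hn⟩ := exists_nat_one_div_lt hε
      exact (interior_subset (hk n) x).trans hn
  rw [this]
  exact isOpenInter_nat fun n => isOpen_interior

/-- The right periods of a bump function f with f(1) = 1 satisfy f(k) = 1, so they form a closed
subgroup inside the compact support of f. -/
theorem exists_cosetChar_le_aleph0 [LocallyCompactSpace G] :
    ∃ K : CompactSubgroup G, K.cosetChar ≤ ℵ₀ := by
  obtain ⟨f, hf1, -, hfs, -⟩ := exists_continuous_one_zero_of_isCompact
    (isCompact_singleton (x := (1 : G))) isClosed_empty (disjoint_empty _)
  have hsub : (rightPeriods f : Set G) ⊆ tsupport f := fun k hk => by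
    refine subset_tsupport _ ?_
    have : f (1 * k) = f 1 := hk 1
    rw [Function.mem_support, ← one_mul k, this, hf1 rfl]
    simp
  have hcomp := hfs.isCompact.of_isClosed_subset (isClosed_rightPeriods f.continuous) hsub
  exact ⟨⟨rightPeriods f, hcomp⟩, cosetChar_le_of_isOpenInter le_rfl
    (isOpenInter_rightPeriods f.continuous hfs)⟩

end Character
end RadonConv

namespace RadonConv

open RadonMeasure

/-! ### Solid subspaces, singularity and bands -/

section Bands

/-- In the Lebesgue decomposition of p, the set S carries q and is null for the singular part of p.
-/
theorem exists_restrict_absolutelyContinuous {X : Type*} [MeasurableSpace X] (p q : Measure X)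
    [IsFiniteMeasure p] [IsFiniteMeasure q] :
    ∃ S, MeasurableSet S ∧ q Sᶜ = 0 ∧ p.restrict S ≪ q := by
  obtain ⟨S, hS, h1, h2⟩ := Measure.mutuallySingular_singularPart p q
  refine ⟨S, hS, h2, ?_⟩
  rw [Measure.haveLebesgueDecomposition_add p q, Measure.restrict_add,
    Measure.restrict_eq_zero.mpr h1, zero_add]
  exact Measure.restrict_le_self.absolutelyContinuous.trans
    (withDensity_absolutelyContinuous _ _)

theorem exists_pos_measure_lt_of_absolutelyContinuous {X : Type*} [MeasurableSpace X]
    {p q : Measure X} [IsFiniteMeasure p] [IsFiniteMeasure q] (h : p ≪ q) {ε : ℝ≥0∞}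
    (hε : ε ≠ 0) : ∃ δ > 0, ∀ S, MeasurableSet S → q S < δ → p S < ε := by
  obtain ⟨δ, hδ, H⟩ := exists_pos_setLIntegral_lt_of_measure_lt
    (Measure.lintegral_rnDeriv_lt_top p q).ne hε
  refine ⟨δ, hδ, fun S hS hlt => ?_⟩
  have := H S hlt
  rwa [← withDensity_apply _ hS, Measure.withDensity_rnDeriv_eq p q h] at this

variable {𝕜 : Type*} [RCLike 𝕜] {G : Type*} [TopologicalSpace G] [T2Space G]
  [MeasurableSpace G] [BorelSpace G]

/-- The subspace `V` contains all measures that are absolutely continuous with respect to one of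
its members. -/
def IsSolid (V : Submodule 𝕜 (RadonMeasure 𝕜 G)) : Prop :=
  ∀ μ ∈ V, ∀ ν : RadonMeasure 𝕜 G, ν.tv ≪ μ.tv → ν ∈ V

theorem mem_closure_of_restr {V : Set (RadonMeasure 𝕜 G)} {ν : RadonMeasure 𝕜 G}
    (h : ∀ ε : ℝ≥0∞, ε ≠ 0 → ∃ S, MeasurableSet S ∧ ν.tv Sᶜ < ε ∧ ν.restr S ∈ V) :
    ν ∈ closure V := by
  refine EMetric.mem_closure_iff.mpr fun ε hε => ?_
  obtain ⟨S, hS, hlt, hV⟩ := h ε hε.ne'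
  refine ⟨_, hV, ?_⟩
  have := norm_sub_restr ν hS MeasurableSet.univ (subset_univ S)
  rw [restr_univ, ← compl_eq_univ_sdiff] at this
  rwa [edist_eq_enorm_sub, this]

/-- Choose μ' ∈ V close to μ and a set S carrying μ' on which ν ≪ μ'. Then the restriction of ν to S
lies in V. Off S the measure μ' vanishes, so |μ| is small there, and hence so is |ν| by absolute
continuity. -/
theorem IsSolid.topologicalClosure {V : Submodule 𝕜 (RadonMeasure 𝕜 G)} (hV : IsSolid V) :
    IsSolid V.topologicalClosure := by
  intro μ hμ ν hν
  refine mem_closure_of_restr fun ε hε => ?_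
  obtain ⟨δ, hδ, H⟩ := exists_pos_measure_lt_of_absolutelyContinuous hν hε
  obtain ⟨μ', hμ', hlt⟩ := EMetric.mem_closure_iff.mp hμ δ hδ
  obtain ⟨S, hS, h1, h2⟩ := exists_restrict_absolutelyContinuous ν.tv μ'.tv
  refine ⟨S, hS, H _ hS.compl (lt_of_le_of_lt (tv_le_add_enorm_sub μ μ' _) ?_), ?_⟩
  · rwa [h1, zero_add, ← edist_eq_enorm_sub]
  · exact hV μ' hμ' _ (by rwa [tv_restr _ hS])

/-- The measures that are singular to all members of `V`. -/
def perp (V : Set (RadonMeasure 𝕜 G)) : Submodule 𝕜 (RadonMeasure 𝕜 G) where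
  carrier := {μ | ∀ ν ∈ V, μ.tv ⟂ₘ ν.tv}
  zero_mem' := fun ν _ => by
    rw [tv_zero]
    exact Measure.MutuallySingular.zero_left
  add_mem' := fun {μ μ'} hμ hμ' ν hν =>
    ((hμ ν hν).add_left (hμ' ν hν)).mono (tv_add_le μ μ') le_rfl
  smul_mem' := fun c μ hμ ν hν =>
    (hμ ν hν).mono_ac (tv_smul_absolutelyContinuous c μ) Measure.AbsolutelyContinuous.rfl

theorem isSolid_perp (V : Set (RadonMeasure 𝕜 G)) : IsSolid (perp V) :=
  fun _ hμ _ hν _ hv => (hμ _ hv).mono_ac hν Measure.AbsolutelyContinuous.rfl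

/-- Approximants ν within 1/(n+1) of μ give sets that carry m, are null for ν and hence have small
|μ|-measure. Their intersection separates μ from m. -/
theorem mutuallySingular_of_mem_closure {V : Set (RadonMeasure 𝕜 G)} {μ : RadonMeasure 𝕜 G}
    {m : Measure G} (h : ∀ ν ∈ V, ν.tv ⟂ₘ m) (hμ : μ ∈ closure V) : μ.tv ⟂ₘ m := by
  have hex : ∀ n : ℕ, ∃ S, MeasurableSet S ∧ μ.tv S < ((n : ℝ≥0∞) + 1)⁻¹ ∧ m Sᶜ = 0 := fun n => by
    obtain ⟨ν, hν, hlt⟩ := EMetric.mem_closure_iff.mp hμ ((n : ℝ≥0∞) + 1)⁻¹ (by simp)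
    obtain ⟨S, hS, h1, h2⟩ := h ν hν
    refine ⟨S, hS, lt_of_le_of_lt (tv_le_add_enorm_sub μ ν _) ?_, h2⟩
    rwa [h1, zero_add, ← edist_eq_enorm_sub]
  choose S hS h1 h2 using hex
  refine ⟨⋂ n, S n, MeasurableSet.iInter hS, ?_, ?_⟩
  · refine le_antisymm (le_of_forall_gt fun ε hε => ?_) zero_le
    obtain ⟨n, hn⟩ := ENNReal.exists_inv_nat_lt hε.ne'
    calc μ.tv (⋂ n, S n) ≤ μ.tv (S n) := measure_mono (iInter_subset _ _)
      _ < ((n : ℝ≥0∞) + 1)⁻¹ := h1 n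
      _ ≤ (n : ℝ≥0∞)⁻¹ := by gcongr; exact le_self_add
      _ < ε := hn
  · rw [compl_iInter]
    exact measure_iUnion_null h2

theorem isClosed_perp (V : Set (RadonMeasure 𝕜 G)) :
    IsClosed (perp V : Set (RadonMeasure 𝕜 G)) :=
  isClosed_of_closure_subset fun _ hμ ν hν =>
    mutuallySingular_of_mem_closure (V := (perp V : Set (RadonMeasure 𝕜 G)))
      (fun v (h : v ∈ perp V) => h ν hν) hμ

/-- Thus singularity to all measures of character below τ is the same as singularity to the closure
of their span of characters. -/
theorem perp_closure (V : Set (RadonMeasure 𝕜 G)) : perp (closure V) = perp V := by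
  refine le_antisymm (fun μ hμ ν hν => hμ ν (subset_closure hν)) fun μ hμ ν hν => ?_
  exact (mutuallySingular_of_mem_closure (fun v hv => (hμ v hv).symm) hν).symm

theorem eq_zero_of_mem_perp {V : Set (RadonMeasure 𝕜 G)} {μ : RadonMeasure 𝕜 G} (h : μ ∈ V)
    (h' : μ ∈ perp V) : μ = 0 :=
  tv_eq_zero (Measure.MutuallySingular.self_iff _ |>.mp (h' μ h))

/-- A closed solid subspace is a band: every measure splits into its restriction to a set, which
belongs to the subspace, and a part that is singular to the subspace. -/
theorem IsSolid.exists_restr_mem {V : Submodule 𝕜 (RadonMeasure 𝕜 G)} (hV : IsSolid V)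
    (hcl : IsClosed (V : Set (RadonMeasure 𝕜 G))) (μ : RadonMeasure 𝕜 G) :
    ∃ A, MeasurableSet A ∧ μ.restr A ∈ V ∧ μ.restr Aᶜ ∈ perp (V : Set (RadonMeasure 𝕜 G)) := by
  -- Exhaustion: 𝒜 is stable under measurable subsets and, V being closed, under countable unions.
  -- It therefore has a member of maximal |μ|-measure.
  let 𝒜 : Set (Set G) := {A | MeasurableSet A ∧ μ.restr A ∈ V}
  have hsub : ∀ {A B}, B ∈ 𝒜 → MeasurableSet A → A ⊆ B → A ∈ 𝒜 := fun {A B} hB hA hAB => by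
    refine ⟨hA, hV _ hB.2 _ ?_⟩
    rw [tv_restr _ hA, tv_restr _ hB.1]
    exact (Measure.restrict_mono hAB le_rfl).absolutelyContinuous
  have hunion : ∀ {A B}, A ∈ 𝒜 → B ∈ 𝒜 → A ∪ B ∈ 𝒜 := fun {A B} hA hB => by
    refine ⟨hA.1.union hB.1, ?_⟩
    rw [← restr_add_restr_diff μ hA.1 (hA.1.union hB.1) subset_union_left]
    refine V.add_mem hA.2 (hsub hB ((hA.1.union hB.1).diff hA.1) ?_).2
    rw [union_sdiff_left]
    exact sdiff_subset
  have hiUnion : ∀ A : ℕ → Set G, (∀ n, A n ∈ 𝒜) → ⋃ n, A n ∈ 𝒜 := by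
    intro A hA
    have hm : MeasurableSet (⋃ n, A n) := MeasurableSet.iUnion fun n => (hA n).1
    have hacc : ∀ n, accumulate A n ∈ 𝒜 := by
      intro n
      induction n with
      | zero => simpa [accumulate_def] using hA 0
      | succ n ih => rw [accumulate_succ]; exact hunion ih (hA _)
    have hle : ∀ n, accumulate A n ⊆ ⋃ n, A n := accumulate_subset_iUnion
    refine ⟨hm, ?_⟩
    have hlim : Tendsto (fun n => μ.tv ((⋃ n, A n) \ accumulate A n)) atTop (𝓝 0) := by
      have := ENNReal.Tendsto.sub (tendsto_const_nhds (x := μ.tv (⋃ n, A n)))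
        (tendsto_measure_iUnion_accumulate (μ := μ.tv) (f := A)) (Or.inl (measure_ne_top _ _))
      rw [tsub_self] at this
      refine this.congr fun n => ?_
      rw [measure_sdiff (hle n) (hacc n).1.nullMeasurableSet (measure_ne_top _ _)]
    refine hcl.mem_of_tendsto (b := atTop) (f := fun n => μ.restr (accumulate A n)) ?_
      (Eventually.of_forall fun n => (hacc n).2)
    rw [tendsto_iff_edist_tendsto_0]
    refine hlim.congr fun n => ?_
    rw [edist_comm, edist_eq_enorm_sub, norm_sub_restr _ (hacc n).1 hm (hle n)]
  have hne : (μ.tv '' 𝒜).Nonempty := ⟨_, ∅, ⟨MeasurableSet.empty, by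
    have : μ.restr ∅ = 0 := tv_eq_zero (by rw [tv_restr _ MeasurableSet.empty]; simp)
    rw [this]
    exact V.zero_mem⟩, rfl⟩
  obtain ⟨u, -, hu, hmem⟩ := exists_seq_tendsto_sSup hne (OrderTop.bddAbove _)
  choose A hA hAu using hmem
  have hU := hiUnion A hA
  have hmax : ∀ B ∈ 𝒜, μ.tv B ≤ μ.tv (⋃ n, A n) := fun B hB => by
    refine (le_sSup (mem_image_of_mem _ hB)).trans (le_of_tendsto' hu fun n => ?_)
    rw [← hAu]
    exact measure_mono (subset_iUnion A n)
  refine ⟨_, hU.1, hU.2, fun ν hν => ?_⟩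
  -- The part of the complement on which |μ| is absolutely continuous with respect to |ν| belongs to
  -- 𝒜 by solidity, so maximality makes it |μ|-null.
  obtain ⟨S, hS, h1, h2⟩ := exists_restrict_absolutelyContinuous (μ.restr (⋃ n, A n)ᶜ).tv ν.tv
  rw [tv_restr _ hU.1.compl, Measure.restrict_restrict hS] at h2
  rw [tv_restr _ hU.1.compl]
  refine ⟨S, hS, ?_, h1⟩
  have hm := hS.inter hU.1.compl
  have hT : S ∩ (⋃ n, A n)ᶜ ∈ 𝒜 := ⟨hm, hV ν hν _ (by rwa [tv_restr _ hm])⟩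
  have h3 := hmax _ (hunion hU hT)
  rw [measure_union (disjoint_compl_right.mono_right inter_subset_right) hm] at h3
  rw [Measure.restrict_apply hS]
  exact le_antisymm (ENNReal.le_of_add_le_add_left (measure_ne_top μ.tv (⋃ n, A n))
    (by rwa [add_zero])) zero_le

end Bands
end RadonConv

namespace RadonConv

open RadonMeasure

/-! ### The spaces M_τ(G), M_a(G) and M_s(G) -/

section CharacterClasses

universe u

variable {𝕜 : Type*} [RCLike 𝕜] {G : Type u} [Group G] [TopologicalSpace G] [IsTopologicalGroup G]
  [T2Space G] [LocallyCompactSpace G] [MeasurableSpace G] [BorelSpace G]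

theorem mem_charMeas_iff {τ : Cardinal.{u}} (hτ : ℵ₀ ≤ τ) {μ : RadonMeasure 𝕜 G} :
    μ ∈ charMeas 𝕜 G τ ↔ ∃ K : CompactSubgroup G, IsOpenInter τ (K.1 : Set G) ∧
      μ ∈ rightInv 𝕜 (K.1 : Set G) := by
  simp only [charMeas, mem_ofPred_eq, cosetChar_le_iff hτ, cosetMeas_eq_rightInv, SetLike.mem_coe]

theorem charMeas_mono {τ τ' : Cardinal.{u}} (h : τ ≤ τ') :
    charMeas 𝕜 G τ ⊆ charMeas 𝕜 G τ' :=
  fun _ ⟨K, hK, hμ⟩ => ⟨K, hK.trans h, hμ⟩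

variable (𝕜 G) in
/-- `M_τ(G)` as a linear subspace. -/
def charSubmodule (τ : Cardinal.{u}) (hτ : ℵ₀ ≤ τ) : Submodule 𝕜 (RadonMeasure 𝕜 G) where
  carrier := charMeas 𝕜 G τ
  zero_mem' := by
    obtain ⟨K, hK⟩ := exists_cosetChar_le_aleph0 (G := G)
    refine ⟨K, hK.trans hτ, ?_⟩
    rw [cosetMeas_eq_rightInv]
    exact (rightInv 𝕜 (K.1 : Set G)).zero_mem
  add_mem' := fun {μ ν} hμ hν => by
    rw [mem_charMeas_iff hτ] at hμ hν ⊢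
    obtain ⟨K, hK, hμ⟩ := hμ
    obtain ⟨L, hL, hν⟩ := hν
    refine ⟨⟨K.1 ⊓ L.1, K.2.inter_right L.2.isClosed⟩, hK.inter hτ hL, ?_⟩
    exact Submodule.add_mem _ (rightInv_anti inter_subset_left hμ)
      (rightInv_anti inter_subset_right hν)
  smul_mem' := fun c μ hμ => by
    rw [mem_charMeas_iff hτ] at hμ ⊢
    obtain ⟨K, hK, hμ⟩ := hμ
    exact ⟨K, hK, Submodule.smul_mem _ c hμ⟩

/-- The limit of a sequence of measures invariant under compact subgroups K_n is invariant under ⋂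
K_n, which is again compact and an intersection of at most ℵ₀ · τ = τ open sets. -/
theorem isClosed_charMeas {τ : Cardinal.{u}} (hτ : ℵ₀ ≤ τ) : IsClosed (charMeas 𝕜 G τ) := by
  refine isClosed_of_closure_subset fun μ hμ => ?_
  obtain ⟨u, hu, hlim⟩ := mem_closure_iff_seq_limit.mp hμ
  simp only [mem_charMeas_iff hτ] at hu ⊢
  choose K hK hu using hu
  have hcoe : ((⨅ n, (K n).1 : Subgroup G) : Set G) = ⋂ n, ((K n).1 : Set G) := by simp
  have hcomp : IsCompact ((⨅ n, (K n).1 : Subgroup G) : Set G) := by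
    rw [hcoe]
    exact (K 0).2.of_isClosed_subset (isClosed_iInter fun n => (K n).2.isClosed)
      (iInter_subset _ 0)
  refine ⟨⟨⨅ n, (K n).1, hcomp⟩, ?_, ?_⟩
  · simp only [hcoe]
    exact isOpenInter_iInter hτ hK
  · refine (isClosed_rightInv _).mem_of_tendsto hlim (Eventually.of_forall fun n => ?_)
    refine rightInv_anti ?_ (hu n)
    simp only [hcoe]
    exact iInter_subset _ n

theorem withDensityᵥ_mem_rightInv {μ σ : RadonMeasure 𝕜 G} {S : Set G} (hμ : μ ∈ rightInv 𝕜 S)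
    {g : G → 𝕜} (hg : Integrable g μ.tv) (hσ : σ.1 = μ.tv.withDensityᵥ g) :
    σ ∈ rightInv 𝕜 (S ∩ rightPeriods g) := by
  rintro k ⟨hk, hk'⟩ E hE
  have hk' : ∀ x, g (x * k) = g x := hk'
  have hme : MeasurableEmbedding fun x : G => x * k :=
    (Homeomorph.mulRight k).measurableEmbedding
  rw [hσ, withDensityᵥ_apply hg hE,
    withDensityᵥ_apply hg (measurableSet_preimage_mul_right hE k)]
  conv_rhs => rw [← tv_map_mul_right hμ hk]
  rw [hme.setIntegral_map]
  simp_rw [hk']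

/-- It suffices to approximate an indicator c·1_s. With K ⊆ s compact and U ⊇ K open, a Urysohn
function between K and U differs from 1_s only on s \ K and U \ K, each of measure below δ. This
accounts for the factor 2‖c‖ in the choice of δ. -/
theorem exists_hasCompactSupport_lintegral_sub_le {X : Type*} [TopologicalSpace X] [T2Space X]
    [LocallyCompactSpace X] [MeasurableSpace X] [BorelSpace X] {m : Measure X} [IsFiniteMeasure m]
    [m.Regular] {f : X → 𝕜} (hf : Integrable f m) {ε : ℝ≥0∞} (hε : ε ≠ 0) :
    ∃ g : X → 𝕜, ∫⁻ x, ‖f x - g x‖ₑ ∂m ≤ ε ∧ HasCompactSupport g ∧ Continuous g := by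
  rw [← memLp_one_iff_integrable] at hf
  simp_rw [← Pi.sub_apply, ← eLpNorm_one_eq_lintegral_enorm]
  refine hf.induction_dense ENNReal.one_ne_top
    (fun g => HasCompactSupport g ∧ Continuous g) ?_ ?_ ?_ hε
  · intro c s hs _ ε hε
    obtain ⟨δ, hδ0, hδ⟩ := ENNReal.exists_nnreal_pos_mul_lt (a := 2 * ‖c‖ₑ) (by finiteness) hε
    have hδe : (δ : ℝ≥0∞) ≠ 0 := by exact_mod_cast hδ0.ne'
    obtain ⟨K, hKs, hK, hKlt⟩ := hs.exists_isCompact_sdiff_lt (measure_ne_top m s) hδe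
    obtain ⟨U, hKU, hU, -, hUlt⟩ := hK.measurableSet.exists_isOpen_sdiff_lt
      (measure_ne_top m K) hδe
    obtain ⟨h, hh1, hh0, hhs, hh⟩ := exists_continuous_one_zero_of_isCompact hK
      hU.isClosed_compl (disjoint_compl_right_iff_subset.mpr hKU)
    refine ⟨fun x => (h x : 𝕜) * c, ?_, ?_, ?_⟩
    · have hpt : ∀ x, ‖(h x : 𝕜) * c - s.indicator (fun _ => c) x‖ₑ ≤
          (s \ K).indicator (fun _ => ‖c‖ₑ) x + (U \ K).indicator (fun _ => ‖c‖ₑ) x := by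
        intro x
        by_cases hxK : x ∈ K
        · simp [hh1 hxK, hKs hxK]
        have hle : ∀ t : ℝ, t ∈ Icc (0 : ℝ) 1 → ‖(t : 𝕜) * c‖ₑ ≤ ‖c‖ₑ := fun t ht => by
          refine enorm_le_iff_norm_le.mpr ?_
          rw [norm_mul, RCLike.norm_ofReal, abs_of_nonneg ht.1]
          exact mul_le_of_le_one_left (norm_nonneg _) ht.2
        by_cases hxs : x ∈ s
        · refine le_add_right ?_
          have : (h x : 𝕜) * c - c = -(((1 - h x : ℝ) : 𝕜) * c) := by push_cast; ring
          rw [indicator_of_mem hxs, indicator_of_mem (show x ∈ s \ K from ⟨hxs, hxK⟩), this,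
            enorm_neg]
          exact hle _ ⟨sub_nonneg.mpr (hh x).2, sub_le_self _ (hh x).1⟩
        · by_cases hxU : x ∈ U
          · refine le_add_left ?_
            rw [indicator_of_notMem hxs, indicator_of_mem (show x ∈ U \ K from ⟨hxU, hxK⟩),
              sub_zero]
            exact hle _ (hh x)
          · simp [hxs, hh0 hxU]
      rw [eLpNorm_one_eq_lintegral_enorm]
      calc ∫⁻ x, ‖(h x : 𝕜) * c - s.indicator (fun _ => c) x‖ₑ ∂m
          ≤ ∫⁻ x, ((s \ K).indicator (fun _ => ‖c‖ₑ) x + (U \ K).indicator (fun _ => ‖c‖ₑ) x) ∂m :=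
            lintegral_mono hpt
        _ = ‖c‖ₑ * m (s \ K) + ‖c‖ₑ * m (U \ K) := by
            rw [lintegral_add_left (measurable_const.indicator (hs.diff hK.measurableSet)),
              lintegral_indicator_const (hs.diff hK.measurableSet),
              lintegral_indicator_const (hU.measurableSet.diff hK.measurableSet)]
        _ ≤ ‖c‖ₑ * δ + ‖c‖ₑ * δ := by gcongr
        _ = δ * (2 * ‖c‖ₑ) := by ring
        _ ≤ ε := hδ.le
    · exact (hhs.comp_left (g := fun t : ℝ => (t : 𝕜)) (by simp)).mul_right
    · fun_prop
  · exact fun f g hf hg => ⟨hf.1.add hg.1, hf.2.add hg.2⟩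
  · exact fun f hf => hf.2.measurable.aestronglyMeasurable

/-- Let ν = f|μ| with μ right K-invariant, and approximate f in L¹(|μ|) by g continuous with compact
support. Then g|μ| is invariant under the right periods of g lying in K, a compact intersection of
at most τ open sets. So ν is a norm limit of elements of the closed set M_τ(G). -/
theorem isSolid_charSubmodule {τ : Cardinal.{u}} (hτ : ℵ₀ ≤ τ) :
    IsSolid (charSubmodule 𝕜 G τ hτ) := by
  intro μ hμ ν hν
  change ν ∈ charMeas 𝕜 G τ
  obtain ⟨K, hK, hμ⟩ := (mem_charMeas_iff hτ).mp hμ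
  rw [← (isClosed_charMeas hτ).closure_eq]
  obtain ⟨f, hf, hfν⟩ := exists_density (ν := ν.1) (m := μ.tv) hν
  refine EMetric.mem_closure_iff.mpr fun ε hε => ?_
  obtain ⟨δ, hδ0, hδ⟩ := exists_between hε
  obtain ⟨g, hgle, hgs, hgc⟩ := exists_hasCompactSupport_lintegral_sub_le hf hδ0.ne'
  have hg : Integrable g μ.tv := hgc.integrable_of_hasCompactSupport hgs
  obtain ⟨B, hB⟩ := hgc.bounded_above_of_compact_support hgs
  have hle : (μ.tv.withDensity fun x => ‖g x‖ₑ) ≤ B.toNNReal • μ.tv := by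
    refine (withDensity_mono (g := fun _ => (B.toNNReal : ℝ≥0∞)) (ae_of_all _ fun x => ?_)).trans
      (le_of_eq ?_)
    · simp only
      rw [← ofReal_norm]
      exact ENNReal.ofReal_le_ofReal (hB x)
    · rw [withDensity_const]; rfl
  obtain ⟨σ, hσ⟩ := exists_eq_withDensityᵥ hg hle
  refine ⟨σ, (mem_charMeas_iff hτ).mpr ⟨⟨K.1 ⊓ rightPeriods g,
    K.2.inter_right (isClosed_rightPeriods hgc)⟩,
    hK.inter hτ ((isOpenInter_rightPeriods hgc hgs).mono hτ),
    withDensityᵥ_mem_rightInv hμ hg hσ⟩, ?_⟩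
  rw [edist_eq_enorm_sub, norm_sub_withDensityᵥ hf hg hfν.symm hσ]
  exact hgle.trans_lt hδ

theorem exists_isCompact_measure_compl_eq_zero (m : Measure G) [IsFiniteMeasure m] [m.Regular] :
    ∃ C : ℕ → Set G, (∀ n, IsCompact (C n)) ∧ m (⋃ n, C n)ᶜ = 0 := by
  have hex : ∀ n : ℕ, ∃ C : Set G, IsCompact C ∧ m Cᶜ < ((n : ℝ≥0∞) + 1)⁻¹ := fun n => by
    obtain ⟨C, -, hC, hlt⟩ := MeasurableSet.univ.exists_isCompact_sdiff_lt
      (measure_ne_top m univ) (ε := ((n : ℝ≥0∞) + 1)⁻¹) (by simp)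
    exact ⟨C, hC, by rwa [compl_eq_univ_sdiff]⟩
  choose C hC hlt using hex
  refine ⟨C, hC, le_antisymm (le_of_forall_gt fun ε hε => ?_) zero_le⟩
  obtain ⟨n, hn⟩ := ENNReal.exists_inv_nat_lt hε.ne'
  calc m (⋃ n, C n)ᶜ ≤ m (C n)ᶜ := measure_mono (compl_subset_compl.mpr (subset_iUnion C n))
    _ < ((n : ℝ≥0∞) + 1)⁻¹ := hlt n
    _ ≤ (n : ℝ≥0∞)⁻¹ := by gcongr; exact le_self_add
    _ < ε := hn

theorem conv_mem_charMeas_left {τ : Cardinal.{u}} (hτ : ℵ₀ ≤ τ) {μ : RadonMeasure 𝕜 G}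
    (hμ : μ ∈ charMeas 𝕜 G τ) (ν : RadonMeasure 𝕜 G) : conv ν μ ∈ charMeas 𝕜 G τ := by
  rw [mem_charMeas_iff hτ] at hμ ⊢
  obtain ⟨K, hK, hμ⟩ := hμ
  exact ⟨K, hK, conv_mem_rightInv ν hμ⟩

/-- The measure ν lives on a σ-compact set. If y k y⁻¹ ∈ K for all y in that set, then xyk = (x ·
yky⁻¹)y shows that |μ| ⋆ |ν| is invariant under k, and such k contain a subgroup of the required
kind. As |μ ⋆ ν| ≤ |μ| ⋆ |ν|, solidity finishes the proof. -/
theorem conv_mem_charMeas_right {τ : Cardinal.{u}} (hτ : ℵ₀ ≤ τ) {μ : RadonMeasure 𝕜 G}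
    (hμ : μ ∈ charMeas 𝕜 G τ) (ν : RadonMeasure 𝕜 G) : conv μ ν ∈ charMeas 𝕜 G τ := by
  obtain ⟨K, hK, hμ⟩ := (mem_charMeas_iff hτ).mp hμ
  obtain ⟨C, hC, hC0⟩ := exists_isCompact_measure_compl_eq_zero ν.tv
  obtain ⟨L, hL, -, hLK⟩ := exists_le_conj hτ hK hC
  have := isFiniteMeasure_posConv μ.tv ν.tv
  have := regular_posConv μ.tv ν.tv
  have hp : ofMeasure (posConv μ.tv ν.tv) ∈ charSubmodule 𝕜 G τ hτ := by
    refine (mem_charMeas_iff hτ).mpr ⟨L, hL, ofMeasure_mem_rightInv fun k hk => ?_⟩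
    ext E hE
    rw [Measure.map_apply (continuous_mul_const k).measurable hE, posConv_apply_right _ _ hE,
      posConv_apply_right _ _ (measurableSet_preimage_mul_right hE k)]
    have hae : ∀ᵐ y ∂ν.tv, y ∈ ⋃ n, C n := hC0
    refine lintegral_congr_ae ?_
    filter_upwards [hae] with y hy
    obtain ⟨n, hn⟩ := mem_iUnion.mp hy
    conv_rhs => rw [← tv_map_mul_right hμ (hLK n y hn k hk)]
    rw [Measure.map_apply (continuous_mul_const _).measurable
      (measurableSet_preimage_mul_right hE y)]
    congr 1
    ext x
    simp [mul_assoc]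
  refine isSolid_charSubmodule hτ _ hp _ ?_
  rw [tv_ofMeasure]
  exact (tv_conv_le μ ν).absolutelyContinuous

theorem exists_haar_map_mul_right (k : G) : ∃ c : ℝ≥0,
    (Measure.haar : Measure G).map (· * k) = c • (Measure.haar : Measure G) := by
  have : ((Measure.haar : Measure G).map (· * k)).Regular :=
    Measure.Regular.map (Homeomorph.mulRight k)
  exact ⟨_, Measure.isMulLeftInvariant_eq_smul_of_regular _ _⟩

theorem preimage_mul_right_image_mul (K : Subgroup G) (C : Set G) {k : G} (hk : k ∈ K) :
    (· * k) ⁻¹' ((fun z : G × G => z.1 * z.2) '' (C ×ˢ (K : Set G))) =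
      (fun z : G × G => z.1 * z.2) '' (C ×ˢ (K : Set G)) := by
  ext x
  constructor
  · rintro ⟨⟨a, b⟩, ⟨ha, hb⟩, hab⟩
    exact ⟨(a, b * k⁻¹), ⟨ha, K.mul_mem hb (K.inv_mem hk)⟩, by
      simp only at hab ⊢
      rw [← mul_assoc, hab, mul_inv_cancel_right]⟩
  · rintro ⟨⟨a, b⟩, ⟨ha, hb⟩, rfl⟩
    exact ⟨(a, b * k), ⟨ha, K.mul_mem hb hk⟩, by simp [mul_assoc]⟩

/-- The modular function is trivial on a compact subgroup: for a compact neighbourhood C of 1, the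
set CK is invariant under right translation by k and has positive finite Haar measure, so the
scaling factor is 1. -/
theorem haar_map_mul_right_of_mem (K : CompactSubgroup G) {k : G} (hk : k ∈ K.1) :
    (Measure.haar : Measure G).map (· * k) = Measure.haar := by
  obtain ⟨c, hc⟩ := exists_haar_map_mul_right k
  obtain ⟨C, hC, hC1⟩ := exists_compact_mem_nhds (1 : G)
  let D : Set G := (fun z : G × G => z.1 * z.2) '' (C ×ˢ (K.1 : Set G))
  have hD : IsCompact D := (hC.prod K.2).image continuous_mul
  have hDk : (· * k) ⁻¹' D = D := preimage_mul_right_image_mul K.1 C hk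
  have h0 : (Measure.haar : Measure G) D ≠ 0 := by
    refine (Measure.measure_pos_of_mem_nhds _ (mem_of_superset hC1 fun x hx => ?_)).ne'
    exact ⟨(x, 1), ⟨hx, K.1.one_mem⟩, by simp⟩
  have h1 := congrArg (fun p : Measure G => p D) hc
  simp only [Measure.map_apply (continuous_mul_const k).measurable hD.measurableSet, hDk,
    Measure.smul_apply] at h1
  have h2 : (c : ℝ≥0∞) = 1 := by
    have h3 : (1 : ℝ≥0∞) * (Measure.haar : Measure G) D = c * (Measure.haar : Measure G) D := by
      rw [one_mul]; exact h1
    exact ((ENNReal.mul_left_inj h0 hD.measure_lt_top.ne).mp h3).symm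
  have h3 : c = 1 := by exact_mod_cast h2
  rw [hc, h3, one_smul]

variable (𝕜 G) in
/-- `M_a(G)` as a linear subspace. -/
noncomputable def acSubmodule : Submodule 𝕜 (RadonMeasure 𝕜 G) where
  carrier := acMeas 𝕜 G
  zero_mem' := by
    change (0 : RadonMeasure 𝕜 G).tv ≪ _
    rw [tv_zero]
    exact Measure.AbsolutelyContinuous.zero _
  add_mem' := fun {μ ν} hμ hν =>
    (tv_add_le μ ν).absolutelyContinuous.trans (Measure.AbsolutelyContinuous.add_left hμ hν)
  smul_mem' := fun c μ hμ => (tv_smul_absolutelyContinuous c μ).trans hμ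

theorem isSolid_acSubmodule : IsSolid (acSubmodule 𝕜 G) :=
  fun _ hμ _ hν => hν.trans hμ

theorem isClosed_acMeas : IsClosed (acMeas 𝕜 G) := by
  refine isClosed_of_closure_subset fun μ hμ E hE => ?_
  refine le_antisymm (le_of_forall_gt fun ε hε => ?_) zero_le
  obtain ⟨ν, hν, hlt⟩ := EMetric.mem_closure_iff.mp hμ ε hε
  refine lt_of_le_of_lt (tv_le_add_enorm_sub μ ν E) ?_
  have hν : ν.tv ≪ Measure.haar := hν
  rwa [hν hE, zero_add, ← edist_eq_enorm_sub]

theorem conv_mem_acMeas_left {μ : RadonMeasure 𝕜 G} (hμ : μ ∈ acMeas 𝕜 G)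
    (ν : RadonMeasure 𝕜 G) : conv ν μ ∈ acMeas 𝕜 G := by
  refine (tv_conv_le ν μ).absolutelyContinuous.trans
    (Measure.AbsolutelyContinuous.mk fun E hE h0 => ?_)
  rw [posConv_apply _ _ hE]
  have : ∀ x, μ.tv ((x * ·) ⁻¹' E) = 0 := fun x =>
    hμ (by rwa [measure_preimage_mul])
  simp [this]

theorem conv_mem_acMeas_right {μ : RadonMeasure 𝕜 G} (hμ : μ ∈ acMeas 𝕜 G)
    (ν : RadonMeasure 𝕜 G) : conv μ ν ∈ acMeas 𝕜 G := by
  refine (tv_conv_le μ ν).absolutelyContinuous.trans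
    (Measure.AbsolutelyContinuous.mk fun E hE h0 => ?_)
  rw [posConv_apply_right _ _ hE]
  have : ∀ y, μ.tv ((· * y) ⁻¹' E) = 0 := fun y => by
    obtain ⟨c, hc⟩ := exists_haar_map_mul_right y
    refine hμ ?_
    rw [← Measure.map_apply (continuous_mul_const y).measurable hE, hc, Measure.smul_apply, h0,
      smul_zero]
  simp [this]

/-- Fix a compact subgroup K of countable character. For compact C, Haar measure restricted to CK is
finite and right K-invariant, so by solidity the restriction of μ to C has countable character. Such
restrictions approximate μ in norm. -/
theorem acMeas_subset_charMeas {τ : Cardinal.{u}} (hτ : ℵ₀ ≤ τ) :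
    acMeas 𝕜 G ⊆ charMeas 𝕜 G τ := by
  refine Subset.trans (fun μ hμ => ?_) (charMeas_mono hτ)
  have hμ : μ.tv ≪ Measure.haar := hμ
  obtain ⟨K, hK⟩ := exists_cosetChar_le_aleph0 (G := G)
  rw [← (isClosed_charMeas le_rfl).closure_eq]
  refine mem_closure_of_restr fun ε hε => ?_
  obtain ⟨C, -, hC, hlt⟩ := MeasurableSet.univ.exists_isCompact_sdiff_lt
    (measure_ne_top μ.tv univ) hε
  rw [← compl_eq_univ_sdiff] at hlt
  refine ⟨C, hC.measurableSet, hlt, ?_⟩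
  let D : Set G := (fun z : G × G => z.1 * z.2) '' (C ×ˢ (K.1 : Set G))
  have hD : IsCompact D := (hC.prod K.2).image continuous_mul
  have hDk : ∀ k ∈ K.1, (· * k) ⁻¹' D = D := fun k hk =>
    preimage_mul_right_image_mul K.1 C hk
  have hCD : C ⊆ D := fun x hx => ⟨(x, 1), ⟨hx, K.1.one_mem⟩, by simp⟩
  have hfin : IsFiniteMeasure ((Measure.haar : Measure G).restrict D) :=
    ⟨by simpa using hD.measure_lt_top⟩
  have hreg : ((Measure.haar : Measure G).restrict D).Regular :=
    Measure.Regular.restrict_of_measure_ne_top hD.measure_lt_top.ne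
  have hinv : ofMeasure ((Measure.haar : Measure G).restrict D) ∈
      charSubmodule 𝕜 G ℵ₀ le_rfl := by
    refine ⟨K, hK, ?_⟩
    rw [cosetMeas_eq_rightInv]
    refine ofMeasure_mem_rightInv fun k hk => ?_
    have hme : MeasurableEmbedding fun x : G => x * k :=
      (Homeomorph.mulRight k).measurableEmbedding
    have := hme.restrict_map Measure.haar D
    rwa [hDk k hk, haar_map_mul_right_of_mem K hk, eq_comm] at this
  refine isSolid_charSubmodule le_rfl _ hinv _ ?_
  rw [tv_ofMeasure, tv_restr _ hC.measurableSet]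
  exact (hμ.restrict C).trans (Measure.restrict_mono hCD le_rfl).absolutelyContinuous

/-- Haar measure itself need not lie in M(G). But μ is carried by countably many compact sets, and
the restrictions of Haar measure to these do lie in M_a(G). -/
theorem singMeas_eq_perp : singMeas 𝕜 G = perp (acMeas 𝕜 G) := by
  refine Subset.antisymm (fun μ hμ ν hν => ?_) fun μ hμ => ?_
  · have hμ : μ.tv ⟂ₘ Measure.haar := hμ
    exact hμ.mono_ac Measure.AbsolutelyContinuous.rfl hν
  · have hμ : μ ∈ perp (acMeas 𝕜 G) := hμ
    obtain ⟨C, hC, hC0⟩ := exists_isCompact_measure_compl_eq_zero μ.tv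
    have hn : ∀ n, μ.tv ⟂ₘ (Measure.haar : Measure G).restrict (C n) := by
      intro n
      have hfin : IsFiniteMeasure ((Measure.haar : Measure G).restrict (C n)) :=
        ⟨by simpa using (hC n).measure_lt_top⟩
      have hreg : ((Measure.haar : Measure G).restrict (C n)).Regular :=
        Measure.Regular.restrict_of_measure_ne_top (hC n).measure_lt_top.ne
      have := hμ (ofMeasure ((Measure.haar : Measure G).restrict (C n))) (by
        change RadonMeasure.tv _ ≪ _
        rw [tv_ofMeasure]
        exact Measure.restrict_le_self.absolutelyContinuous)
      rwa [tv_ofMeasure] at this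
    choose S hS h1 h2 using hn
    refine ⟨(⋃ n, C n \ S n)ᶜ,
      (MeasurableSet.iUnion fun n => (hC n).measurableSet.diff (hS n)).compl, ?_, ?_⟩
    · refine measure_mono_null (fun x hx => ?_) (measure_union_null hC0 (measure_iUnion_null h1))
      by_cases hxC : x ∈ ⋃ n, C n
      · obtain ⟨n, hn⟩ := mem_iUnion.mp hxC
        refine Or.inr (mem_iUnion.mpr ⟨n, ?_⟩)
        by_contra hxS
        exact hx (mem_iUnion.mpr ⟨n, hn, hxS⟩)
      · exact Or.inl hxC
    · rw [compl_compl]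
      refine measure_iUnion_null fun n => ?_
      have := h2 n
      rwa [Measure.restrict_apply (hS n).compl, inter_comm, ← sdiff_eq] at this

end CharacterClasses
end RadonConv

namespace RadonConv

open RadonMeasure

/-! ### Approximately invariant and strongly singular measures -/

section Decomposition

universe u

variable {𝕜 : Type*} [RCLike 𝕜] {G : Type u} [Group G] [TopologicalSpace G] [IsTopologicalGroup G]
  [T2Space G] [LocallyCompactSpace G] [MeasurableSpace G] [BorelSpace G]

theorem continuous_conv_left (ν : RadonMeasure 𝕜 G) : Continuous fun μ => conv μ ν := by
  refine LipschitzWith.continuous (K := ‖ν‖₊) fun μ μ' => ?_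
  rw [edist_eq_enorm_sub, edist_eq_enorm_sub, ← conv_sub_left, mul_comm]
  exact enorm_conv_le _ _

theorem continuous_conv_right (ν : RadonMeasure 𝕜 G) : Continuous fun μ => conv ν μ := by
  refine LipschitzWith.continuous (K := ‖ν‖₊) fun μ μ' => ?_
  rw [edist_eq_enorm_sub, edist_eq_enorm_sub, ← conv_sub_right]
  exact enorm_conv_le _ _

variable (𝕜 G) in
/-- The measures of character less than `τ`, as a linear subspace. -/
def charLtSubmodule (τ : Cardinal.{u}) (hτ : ℵ₀ < τ) : Submodule 𝕜 (RadonMeasure 𝕜 G) where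
  carrier := {μ | ∃ τ₁, ∃ _ : ℵ₀ ≤ τ₁, τ₁ < τ ∧ μ ∈ charMeas 𝕜 G τ₁}
  zero_mem' := ⟨ℵ₀, le_rfl, hτ, (charSubmodule 𝕜 G ℵ₀ le_rfl).zero_mem⟩
  add_mem' := by
    rintro μ ν ⟨τ₁, h1, h1τ, hμ⟩ ⟨τ₂, h2, h2τ, hν⟩
    have h : ℵ₀ ≤ max τ₁ τ₂ := h1.trans (le_max_left _ _)
    exact ⟨max τ₁ τ₂, h, max_lt h1τ h2τ, (charSubmodule 𝕜 G _ h).add_mem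
      (charMeas_mono (le_max_left _ _) hμ) (charMeas_mono (le_max_right _ _) hν)⟩
  smul_mem' := by
    rintro c μ ⟨τ₁, h1, h1τ, hμ⟩
    exact ⟨τ₁, h1, h1τ, (charSubmodule 𝕜 G _ h1).smul_mem c hμ⟩

theorem isSolid_charLtSubmodule {τ : Cardinal.{u}} (hτ : ℵ₀ < τ) :
    IsSolid (charLtSubmodule 𝕜 G τ hτ) := by
  rintro μ ⟨τ₁, h1, h1τ, hμ⟩ ν hν
  exact ⟨τ₁, h1, h1τ, isSolid_charSubmodule h1 μ hμ ν hν⟩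

theorem norm_conv_haarMeas_le (μ : RadonMeasure 𝕜 G) (K : CompactSubgroup G) :
    ‖conv μ (ofMeasure K.haarMeas)‖ ≤ ‖μ‖ :=
  enorm_le_iff_norm_le.mp (enorm_conv_haarMeas_le μ K)

theorem closure_charLt_subset {τ : Cardinal.{u}} (hτ : ℵ₀ < τ) :
    closure (charLtSubmodule 𝕜 G τ hτ : Set (RadonMeasure 𝕜 G)) ⊆ charMeas 𝕜 G τ :=
  closure_minimal (fun _ ⟨_, _, h1τ, hμ⟩ => charMeas_mono h1τ.le hμ) (isClosed_charMeas hτ.le)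

/-- Each μ ⋆ λ_K with χ(G/K) < τ has character below τ, so limits of the net lie in the closure.
Conversely, if ν is K₀-invariant and K ≤ K₀, then ν ⋆ λ_K = ν, whence ‖μ ⋆ λ_K - μ‖ ≤ 2‖μ - ν‖. -/
theorem aiMeas_eq_closure {τ : Cardinal.{u}} (hτ : ℵ₀ < τ) :
    aiMeas 𝕜 G τ = closure (charLtSubmodule 𝕜 G τ hτ) := by
  rw [aiMeas, if_neg hτ.ne']
  refine Subset.antisymm (fun μ hμ => ?_) fun μ hμ => ⟨closure_charLt_subset hτ hμ, ?_⟩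
  · refine Metric.mem_closure_iff.mpr fun ε hε => ?_
    obtain ⟨K, hK, h⟩ := hμ.2 ε hε
    -- The maximum with ℵ₀ covers open K, for which χ(G/K) is finite.
    refine ⟨conv μ (ofMeasure K.haarMeas),
      ⟨max ℵ₀ K.cosetChar, le_max_left _ _, max_lt hτ hK, K, le_max_right _ _, ?_⟩, ?_⟩
    · rw [cosetMeas_eq_rightInv]
      exact conv_mem_rightInv _ (ofMeasure_mem_rightInv fun k hk => haarMeas_map_mul_right K hk)
    · rw [dist_comm, dist_eq_norm]
      exact h K hK le_rfl
  · intro ε hε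
    obtain ⟨ν, ⟨τ₁, h1, h1τ, K₀, hK₀, hν⟩, hlt⟩ :=
      Metric.mem_closure_iff.mp hμ (ε / 2) (half_pos hε)
    refine ⟨K₀, hK₀.trans_lt h1τ, fun K _ hKK => ?_⟩
    rw [cosetMeas_eq_rightInv] at hν
    have hνK := conv_haarMeas_of_mem (rightInv_anti (S := (K.1 : Set G)) hKK hν)
    have heq : conv μ (ofMeasure K.haarMeas) - μ =
        conv (μ - ν) (ofMeasure K.haarMeas) - (μ - ν) := by
      rw [conv_sub_left, hνK]
      abel
    rw [heq]
    rw [dist_eq_norm] at hlt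
    calc ‖conv (μ - ν) (ofMeasure K.haarMeas) - (μ - ν)‖
        ≤ ‖conv (μ - ν) (ofMeasure K.haarMeas)‖ + ‖μ - ν‖ := norm_sub_le _ _
      _ ≤ ‖μ - ν‖ + ‖μ - ν‖ := by gcongr; exact norm_conv_haarMeas_le _ _
      _ < ε := by linarith

/-- Singularity to Haar measure is automatic here, because M_a(G) already consists of measures of
character ℵ₀ < τ. -/
theorem ssMeas_eq_of_aleph0_lt {τ : Cardinal.{u}} (hτ : ℵ₀ < τ) :
    ssMeas 𝕜 G τ = charMeas 𝕜 G τ ∩ perp (aiMeas 𝕜 G τ) := by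
  rw [ssMeas, if_neg hτ.ne', aiMeas_eq_closure hτ, perp_closure]
  ext μ
  constructor
  · rintro ⟨⟨-, hμ⟩, h⟩
    exact ⟨hμ, fun ν ⟨τ₁, h1, h1τ, hν⟩ => h τ₁ h1 h1τ ν hν⟩
  · rintro ⟨hμ, h⟩
    have h : ∀ ν ∈ charLtSubmodule 𝕜 G τ hτ, μ.tv ⟂ₘ ν.tv := h
    refine ⟨⟨?_, hμ⟩, fun τ₁ h1 h1τ ν hν => h ν ⟨τ₁, h1, h1τ, hν⟩⟩
    rw [singMeas_eq_perp]
    exact fun ν hν => h ν ⟨ℵ₀, le_rfl, hτ, acMeas_subset_charMeas le_rfl hν⟩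

/-- The structure of the approximately invariant measures, from which the decomposition of
`M_τ(G)` follows. -/
theorem exists_aiSubmodule (𝕜 : Type*) [RCLike 𝕜] {τ : Cardinal.{u}} (hτ : ℵ₀ ≤ τ) :
    ∃ N : Submodule 𝕜 (RadonMeasure 𝕜 G), (N : Set (RadonMeasure 𝕜 G)) = aiMeas 𝕜 G τ ∧
      IsSolid N ∧ IsClosed (N : Set (RadonMeasure 𝕜 G)) ∧ N ≤ charSubmodule 𝕜 G τ hτ ∧
      (∀ μ ∈ N, ∀ ν, conv μ ν ∈ N ∧ conv ν μ ∈ N) ∧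
      ssMeas 𝕜 G τ = charMeas 𝕜 G τ ∩ perp (N : Set (RadonMeasure 𝕜 G)) := by
  rcases hτ.eq_or_lt with rfl | hlt
  · refine ⟨acSubmodule 𝕜 G, ?_, isSolid_acSubmodule, isClosed_acMeas,
      acMeas_subset_charMeas le_rfl,
      fun μ hμ ν => ⟨conv_mem_acMeas_right hμ ν, conv_mem_acMeas_left hμ ν⟩, ?_⟩
    · rw [aiMeas, if_pos rfl]; rfl
    · rw [ssMeas, if_pos rfl, singMeas_eq_perp, inter_comm]; rfl
  · have hN : ((charLtSubmodule 𝕜 G τ hlt).topologicalClosure : Set (RadonMeasure 𝕜 G)) =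
        aiMeas 𝕜 G τ := (aiMeas_eq_closure hlt).symm
    refine ⟨(charLtSubmodule 𝕜 G τ hlt).topologicalClosure, hN,
      (isSolid_charLtSubmodule hlt).topologicalClosure, isClosed_closure,
      closure_charLt_subset hlt, fun μ hμ ν => ⟨?_, ?_⟩, ?_⟩
    · refine map_mem_closure (f := fun μ => conv μ ν) (continuous_conv_left ν) hμ ?_
      rintro μ ⟨τ₁, h1, h1τ, hμ⟩
      exact ⟨τ₁, h1, h1τ, conv_mem_charMeas_right h1 hμ ν⟩
    · refine map_mem_closure (f := fun μ => conv ν μ) (continuous_conv_right ν) hμ ?_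
      rintro μ ⟨τ₁, h1, h1τ, hμ⟩
      exact ⟨τ₁, h1, h1τ, conv_mem_charMeas_left h1 hμ ν⟩
    · rw [hN, ssMeas_eq_of_aleph0_lt hlt]

/-- Translating by k⁻¹ moves the question to μ and the translate of ν, which is still in N. -/
theorem rightTranslate_mem_perp {N : Submodule 𝕜 (RadonMeasure 𝕜 G)}
    (hN : ∀ k, ∀ ν ∈ N, rightTranslate k ν ∈ N) {μ : RadonMeasure 𝕜 G}
    (hμ : μ ∈ perp (N : Set (RadonMeasure 𝕜 G))) (k : G) :
    rightTranslate k μ ∈ perp (N : Set (RadonMeasure 𝕜 G)) := by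
  intro ν hν
  obtain ⟨S, hS, h1, h2⟩ := hμ _ (hN k⁻¹ ν hν)
  rw [tv_rightTranslate, Measure.map_apply (continuous_mul_const _).measurable hS.compl] at h2
  have hS' := measurableSet_preimage_mul_right hS k⁻¹
  refine ⟨_, hS', ?_, h2⟩
  rw [tv_rightTranslate, Measure.map_apply (continuous_mul_const k).measurable hS']
  simpa [preimage_preimage] using h1

theorem rightTranslate_eq_of_mem {S : Set G} {μ : RadonMeasure 𝕜 G} (hμ : μ ∈ rightInv 𝕜 S)
    {k : G} (hk : k ∈ S) : rightTranslate k μ = μ := by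
  ext E hE
  rw [rightTranslate_apply k μ hE]
  exact hμ k hk E hE

theorem rightTranslate_add (k : G) (μ ν : RadonMeasure 𝕜 G) :
    rightTranslate k (μ + ν) = rightTranslate k μ + rightTranslate k ν := by
  ext E hE
  change _ = (rightTranslate k μ).1 E + (rightTranslate k ν).1 E
  rw [rightTranslate_apply _ _ hE, rightTranslate_apply _ _ hE, rightTranslate_apply _ _ hE]
  rfl

/-- Write R_k for right translation by k ∈ S. Then R_k a - a = b - R_k b lies both in N and in its
singular complement, hence is zero. -/
theorem mem_rightInv_of_decomposition {N : Submodule 𝕜 (RadonMeasure 𝕜 G)}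
    (hN : ∀ k, ∀ ν ∈ N, rightTranslate k ν ∈ N) {S : Set G} {a b : RadonMeasure 𝕜 G}
    (ha : a ∈ N) (hb : b ∈ perp (N : Set (RadonMeasure 𝕜 G))) (hab : a + b ∈ rightInv 𝕜 S) :
    a ∈ rightInv 𝕜 S ∧ b ∈ rightInv 𝕜 S := by
  have haS : a ∈ rightInv 𝕜 S := by
    intro k hk E hE
    have h1 : rightTranslate k a + rightTranslate k b = a + b := by
      rw [← rightTranslate_add, rightTranslate_eq_of_mem hab hk]
    have h2 : rightTranslate k a - a = b - rightTranslate k b := by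
      rw [sub_eq_sub_iff_add_eq_add, h1, add_comm]
    have h3 : rightTranslate k a - a = 0 :=
      eq_zero_of_mem_perp (V := (N : Set (RadonMeasure 𝕜 G))) (N.sub_mem (hN k a ha) ha) (by
        rw [h2]
        exact Submodule.sub_mem _ hb (rightTranslate_mem_perp hN hb k))
    rw [← rightTranslate_apply k a hE, sub_eq_zero.mp h3]
  refine ⟨haS, ?_⟩
  have := Submodule.sub_mem _ hab haS
  rwa [add_sub_cancel_left] at this

end Decomposition
end RadonConv

/-! ### The main theorem -/

theorem mainTheorem10 {𝕜 : Type*} [RCLike 𝕜] {G : Type*} [Group G] [TopologicalSpace G]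
    [IsTopologicalGroup G] [T2Space G] [LocallyCompactSpace G] [MeasurableSpace G] [BorelSpace G]
    (hG : ¬ DiscreteTopology G) :
    (∀ τ : Cardinal, ℵ₀ ≤ τ → τ ≤ localWeight (1 : G) →
      (IsClosedIdeal (charMeas 𝕜 G τ) ∧ IsClosedIdeal (aiMeas 𝕜 G τ) ∧
        IsClosedSubspace (ssMeas 𝕜 G τ)) ∧
      (IsLSubspace (charMeas 𝕜 G τ) ∧ IsLSubspace (aiMeas 𝕜 G τ) ∧
        IsLSubspace (ssMeas 𝕜 G τ) ∧
        IsDirectSum (charMeas 𝕜 G τ) (ssMeas 𝕜 G τ) (aiMeas 𝕜 G τ) ∧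
        SetSingular (ssMeas 𝕜 G τ) (aiMeas 𝕜 G τ))) ∧
    (∀ K : CompactSubgroup G, ¬ IsOpen (K.1 : Set G) →
      (IsClosedSubspace (cosetMeas 𝕜 K) ∧ IsAbsClosed (cosetMeas 𝕜 K)) ∧
      (IsClosedSubspace (aiCosetMeas 𝕜 K) ∧ IsAbsClosed (aiCosetMeas 𝕜 K)) ∧
      (IsClosedSubspace (ssCosetMeas 𝕜 K) ∧ IsAbsClosed (ssCosetMeas 𝕜 K)) ∧
      IsDirectSum (cosetMeas 𝕜 K) (ssCosetMeas 𝕜 K) (aiCosetMeas 𝕜 K) ∧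
      SetSingular (ssCosetMeas 𝕜 K) (aiCosetMeas 𝕜 K)) := by
  refine ⟨fun τ hτ _ => ?_, fun K hK => ?_⟩
  · obtain ⟨N, hN, hsolid, hclosed, hle, hideal, hss⟩ := exists_aiSubmodule (G := G) 𝕜 hτ
    let C := charSubmodule 𝕜 G τ hτ
    let P : Submodule 𝕜 (RadonMeasure 𝕜 G) := C ⊓ perp (N : Set (RadonMeasure 𝕜 G))
    have hP : (P : Set (RadonMeasure 𝕜 G)) = ssMeas 𝕜 G τ := hss.symm
    have hCsolid : IsSolid C := isSolid_charSubmodule hτ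
    rw [← hN, ← hP]
    refine ⟨⟨⟨⟨isClosed_charMeas hτ, C, rfl⟩, fun μ hμ ν =>
        ⟨conv_mem_charMeas_right hτ hμ ν, conv_mem_charMeas_left hτ hμ ν⟩⟩,
      ⟨⟨hclosed, N, rfl⟩, hideal⟩, ⟨(isClosed_charMeas hτ).inter (isClosed_perp _), P, rfl⟩⟩,
      ⟨⟨C, rfl⟩, hCsolid⟩, ⟨⟨N, rfl⟩, hsolid⟩,
      ⟨⟨P, rfl⟩, fun μ hμ ν hν => ⟨hCsolid μ hμ.1 ν hν, isSolid_perp _ μ hμ.2 ν hν⟩⟩,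
      ⟨P, N, C, rfl, rfl, rfl, le_antisymm (sup_le inf_le_left hle) fun μ hμ => ?_, ?_⟩,
      fun μ hμ ν hν => hμ.2 ν hν⟩
    -- The part of μ singular to N stays in M_τ(G), since it is a restriction of μ and M_τ(G) is
    -- solid.
    · obtain ⟨A, hA, h1, h2⟩ := hsolid.exists_restr_mem hclosed μ
      rw [← RadonMeasure.restr_add_restr_compl μ hA, add_comm]
      refine Submodule.add_mem_sup ⟨hCsolid μ hμ _ ?_, h2⟩ h1
      rw [RadonMeasure.tv_restr _ hA.compl]
      exact Measure.restrict_le_self.absolutelyContinuous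
    · exact Submodule.disjoint_def.mpr fun μ hμ hμ' => eq_zero_of_mem_perp hμ' hμ.2
  · have hτ := aleph0_le_cosetChar hK
    obtain ⟨N, hN, hsolid, hclosed, hle, hideal, hss⟩ := exists_aiSubmodule (G := G) 𝕜 hτ
    have htr : ∀ k, ∀ ν ∈ N, rightTranslate k ν ∈ N := fun k ν hν => by
      obtain ⟨δ, hδ⟩ := exists_conv_eq_rightTranslate (𝕜 := 𝕜) k
      rw [← hδ]
      exact (hideal ν hν δ).1
    let C := charSubmodule 𝕜 G K.cosetChar hτ
    have hCsolid : IsSolid C := isSolid_charSubmodule hτ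
    let R : Submodule 𝕜 (RadonMeasure 𝕜 G) := rightInv 𝕜 (K.1 : Set G)
    have hRC : R ≤ C := fun μ hμ => ⟨K, le_rfl, by rw [cosetMeas_eq_rightInv]; exact hμ⟩
    have hRclosed : IsClosed (R : Set (RadonMeasure 𝕜 G)) := isClosed_rightInv _
    have hR : cosetMeas 𝕜 K = R := cosetMeas_eq_rightInv K
    let A : Submodule 𝕜 (RadonMeasure 𝕜 G) := R ⊓ N
    let S : Submodule 𝕜 (RadonMeasure 𝕜 G) := R ⊓ perp (N : Set (RadonMeasure 𝕜 G))
    have hA : aiCosetMeas 𝕜 K = A := by rw [aiCosetMeas, hR, ← hN]; rfl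
    have hS : ssCosetMeas 𝕜 K = S := by
      have h : (R : Set (RadonMeasure 𝕜 G)) ∩ charMeas 𝕜 G K.cosetChar = R :=
        Set.inter_eq_left.mpr fun μ hμ => hRC hμ
      rw [ssCosetMeas, hR, hss, ← Set.inter_assoc, h]
      rfl
    -- Right K-invariance is not inherited by absolutely continuous measures, but it passes to |μ|;
    -- solidity is needed only of the other factor V.
    have habs : ∀ {V : Submodule 𝕜 (RadonMeasure 𝕜 G)}, IsSolid V →
        IsAbsClosed ((R ⊓ V : Submodule 𝕜 (RadonMeasure 𝕜 G)) : Set (RadonMeasure 𝕜 G)) :=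
      fun hV μ hμ => ⟨absVal_mem_rightInv hμ.1, hV μ hμ.2 _ (by
        rw [RadonMeasure.tv_absVal])⟩
    rw [hR, hA, hS]
    refine ⟨⟨⟨hRclosed, R, rfl⟩, fun μ hμ => absVal_mem_rightInv hμ⟩,
      ⟨⟨hRclosed.inter hclosed, A, rfl⟩, habs hsolid⟩,
      ⟨⟨hRclosed.inter (isClosed_perp _), S, rfl⟩, habs (isSolid_perp _)⟩,
      ⟨S, A, R, rfl, rfl, rfl, le_antisymm (sup_le inf_le_left inf_le_left) fun μ hμ => ?_, ?_⟩,
      fun μ hμ ν hν => hμ.2 ν hν.2⟩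
    -- The set B need not be right K-invariant, so invariance of the two restrictions has to come
    -- from uniqueness of the decomposition.
    · obtain ⟨B, hB, h1, h2⟩ := hsolid.exists_restr_mem hclosed μ
      have hsum := RadonMeasure.restr_add_restr_compl μ hB
      obtain ⟨h3, h4⟩ := mem_rightInv_of_decomposition htr h1 h2 (S := (K.1 : Set G))
        (by rw [hsum]; exact hμ)
      rw [← hsum, add_comm]
      exact Submodule.add_mem_sup ⟨h4, h2⟩ ⟨h3, h1⟩
    · exact Submodule.disjoint_def.mpr fun μ hμ hμ' => eq_zero_of_mem_perp hμ'.2 hμ.2
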